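/- **Setting.** Let $n>d>0$ and let $\vec v_1,\dots,\vec v_n$ be pairwise non-colinear vectors of $\mathbb R^d$. An *$n\to d$ tile* is a translate of a parallelotope generated by $d$ linearly independent vectors among the $\vec v_i$'s. An *$n\to d$ tiling* is a covering of $\mathbb R^d$ by $n\to d$ tiles in which any two distinct tiles are disjoint or meet in a common full face of dimension less than $d$. A *lift* of a tiling maps its vertices to $\mathbb Z^n$, some vertex to the origin, so that each edge $\vec v_i$ of a tile becomes an edge $\vec e_i$ ($\vec e_1,\dots,\vec e_n$ is the canonical basis of $\mathbb R^n$); the tile generated by $\vec v_{i_1},\dots,\vec v_{i_d}$ is thereby mapped to a face of a unit hypercube of $\mathbb Z^n$ generated by $\vec e_{i_1},\dots,\vec e_{i_d}$. The tiling is *planar of thickness at most $t$ with slope parallel to $E$* ($E$ a $d$-dimensional linear subspace of $\mathbb R^n$, called a $d$-plane, and $t\ge 1$) if one of its lifts is contained in $A+[0,t]^n$ for some affine subspace $A$ of direction $E$. **Local rules.** A patch is a finite set of tiles. Local rules are a finite set $\mathcal F$ of patches, and $X_{\mathcal F}$ is the set of $n\to d$ tilings in which no translate of a patch of $\mathcal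 F$ occurs. *Colored* local rules are defined in the same way with tiles colored by a finite palette; then $X_{\mathcal F}$ is the set of tilings obtained by removing the colors from the colored tilings in which no translate of a colored patch of $\mathcal F$ occurs. A set $\mathcal E$ of $d$-planes of $\mathbb R^n$ admits *weakened* (colored or uncolored) local rules if there are such local rules $\mathcal F$ and an integer $t\ge 1$ such that 1. for each $E\in\mathcal E$, $X_{\mathcal F}$ contains a planar tiling of thickness at most $t$ with slope parallel to $E$; 2. every tiling in $X_{\mathcal F}$ is planar of thickness at most $t$ with slope parallel to some element of $\mathcal E$. The local rules are *weak* if moreover $t$ is replaced by $1$ in the first condition, and *strong* if $t$ is replaced by $1$ in both. **Computability.** The space of $d$-planes of $\mathbb R^n$ is endowed with the metric $$d(E,F)=\max\Big\{\sup_{x\in E,\ \|x\|=1}\ \inf_{y\in F}\|x-y\|,\ \sup_{x\in F,\ \|x\|=1}\ \inf_{y\in E}\|x-y\|\Big\}.$$ A $d$-plane is *rational* if it is generated by $d$ vectors with rational entries. A set of $d$-planes is *recursively open* if it is the union of the open balls $B(q_k,r_k)$, $k\in\mathbb N$, for some sequence $(q_k)$ of rational $d$-planes (given by rational generating vectors)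 and some sequence $(r_k)$ of rational numbers, both output by an algorithm (a ball whose radius is not positive is empty); it is *recursively closed* if its complement is recursively open. A $d$-plane $E$ is *computable* if there is an algorithm which, given $m\in\mathbb N$, outputs a rational $d$-plane at distance at most $\frac1{m+1}$ from $E$. **Proposition.** Any set of $d$-planes of $\mathbb R^n$ which admits local rules of any type (weakened, weak or strong, colored or not) is recursively closed. In particular, if a single $d$-plane $E$ admits local rules of any type (that is, if $\{E\}$ does), then $E$ is computable. -/

import Mathlib

open Set

noncomputable section

namespace PlanarTilings

variable {n d : ℕ}

/-! ## Tilings by parallelotopes -/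

/-- The vectors `v i` are pairwise non-colinear (in particular all of them are nonzero). -/
def PairwiseNonColinear (v : Fin n → Fin d → ℝ) : Prop :=
  ∀ i j, i ≠ j → LinearIndependent ℝ ![v i, v j]

/-- The parallelotope with base point `p` generated by the `v i`, `i ∈ I`. -/
def parallelotope (v : Fin n → Fin d → ℝ) (p : Fin d → ℝ) (I : Finset (Fin n)) :
    Set (Fin d → ℝ) :=
  {x | ∃ c : Fin n → ℝ, (∀ i, c i ∈ Icc (0 : ℝ) 1) ∧ x = p + ∑ i ∈ I, c i • v i}

/-- An `n → d` tile: a translate of a parallelotope generated by `d` of the vectors `v i`.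
These `d` vectors are linearly independent because a tile is the closure of its interior.
If the `v i` are pairwise non-colinear, the tile, as a subset of `ℝ^d`, determines both fields. -/
@[ext]
structure Tile (v : Fin n → Fin d → ℝ) where
  base : Fin d → ℝ
  dirs : Finset (Fin n)
  card_dirs : dirs.card = d
  linearIndependent : LinearIndependent ℝ (fun i : dirs => v i)

namespace Tile

variable {v : Fin n → Fin d → ℝ}

/-- The subset of `ℝ^d` occupied by a tile. -/
def support (τ : Tile v) : Set (Fin d → ℝ) := parallelotope v τ.base τ.dirs

/-- The translate of a tile by the vector `u`. -/
def translate (u : Fin d → ℝ) (τ : Tile v) : Tile v where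
  base := τ.base + u
  dirs := τ.dirs
  card_dirs := τ.card_dirs
  linearIndependent := τ.linearIndependent

/-- The vertex of a tile reached from its base point along the edges `v i`, `i ∈ S`. -/
def vertex (τ : Tile v) (S : Finset (Fin n)) : Fin d → ℝ := τ.base + ∑ i ∈ S, v i

/-- The full faces of dimension less than `d` of a tile. -/
def properFaces (τ : Tile v) : Set (Set (Fin d → ℝ)) :=
  {f | ∃ A B : Finset (Fin n), A ⊆ τ.dirs ∧ B ⊂ τ.dirs ∧ Disjoint A B ∧
    f = parallelotope v (τ.vertex A) B}

end Tile

variable (v : Fin n → Fin d → ℝ)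

/-- An `n → d` tiling: a face-to-face covering of `ℝ^d` by `n → d` tiles. -/
structure IsTiling (T : Set (Tile v)) : Prop where
  covers : ⋃ τ ∈ T, τ.support = univ
  faceToFace : ∀ τ ∈ T, ∀ σ ∈ T, τ ≠ σ → τ.support ∩ σ.support = ∅ ∨
    (τ.support ∩ σ.support ∈ τ.properFaces ∧ τ.support ∩ σ.support ∈ σ.properFaces)

/-! ## Lifts and planarity -/

variable {v}

/-- The vertices of the tiles of `T`. -/
def vertices (T : Set (Tile v)) : Set (Fin d → ℝ) :=
  {p | ∃ τ ∈ T, ∃ S ⊆ τ.dirs, p = τ.vertex S}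

/-- `L` gives the positions in `ℤ^n` of the vertices of `T` in a lift of `T`: some vertex goes to
the origin, and an edge `v i` of a tile goes to an edge `e i`. Only the values of `L` at
the vertices of `T` matter. -/
def IsLift (T : Set (Tile v)) (L : (Fin d → ℝ) → Fin n → ℤ) : Prop :=
  (∃ p ∈ vertices T, L p = 0) ∧
    ∀ τ ∈ T, ∀ S ⊆ τ.dirs, ∀ i ∈ τ.dirs, i ∉ S →
      L (τ.vertex S + v i) = L (τ.vertex S) + Pi.single i 1

/-- The subset of `ℝ^n` occupied by the lift: the union, over the tiles, of the faces of unit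
hypercubes of `ℤ^n` generated by the `e i` with `i` a direction of the tile. -/
def liftSet (T : Set (Tile v)) (L : (Fin d → ℝ) → Fin n → ℤ) :
    Set (EuclideanSpace ℝ (Fin n)) :=
  {x | ∃ τ ∈ T, ∀ i, (i ∈ τ.dirs → x i - L τ.base i ∈ Icc (0 : ℝ) 1) ∧
    (i ∉ τ.dirs → x i = L τ.base i)}

/-- The tube `A + [0,t]^n`. -/
def tube (A : AffineSubspace ℝ (EuclideanSpace ℝ (Fin n))) (t : ℕ) :
    Set (EuclideanSpace ℝ (Fin n)) :=
  {x | ∃ y ∈ A, ∀ i, x i - y i ∈ Icc (0 : ℝ) t}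

/-- The (linear) `d`-planes of `ℝ^n`. -/
abbrev Plane (d n : ℕ) : Type :=
  {W : Submodule ℝ (EuclideanSpace ℝ (Fin n)) // Module.finrank ℝ W = d}

/-- The tiling `T` is planar of thickness at most `t`, with a slope parallel to `E`. -/
def IsPlanar (T : Set (Tile v)) (E : Plane d n) (t : ℕ) : Prop :=
  ∃ A : AffineSubspace ℝ (EuclideanSpace ℝ (Fin n)), A.direction = E.1 ∧
    ∃ L, IsLift T L ∧ liftSet T L ⊆ tube A t

/-! ## Local rules

A patch is a finite set of tiles; local rules are a finite set of (forbidden) patches. Finite sets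
of tiles that occur in no tiling are harmless: forbidding them forbids nothing. -/

/-- A translate of the patch `P` occurs in `T`. -/
def Occurs (P : Finset (Tile v)) (T : Set (Tile v)) : Prop :=
  ∃ u, ∀ τ ∈ P, τ.translate u ∈ T

/-- A translate of the colored patch `P` occurs in the tiling `T` whose tiles are colored by `c`. -/
def ColoredOccurs {k : ℕ} (P : Finset (Tile v × Fin k)) (T : Set (Tile v))
    (c : T → Fin k) : Prop :=
  ∃ u, ∀ a ∈ P, ∃ h : a.1.translate u ∈ T, c ⟨a.1.translate u, h⟩ = a.2

/-- The tilings in which no patch of `F` occurs. -/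
def tilingSpace (F : Finset (Finset (Tile v))) : Set (Set (Tile v)) :=
  {T | IsTiling v T ∧ ∀ P ∈ F, ¬ Occurs P T}

/-- The tilings obtained by removing the colors from the tilings, with tiles colored by a palette of
`k` colors, in which no colored patch of `F` occurs. -/
def coloredTilingSpace {k : ℕ} (F : Finset (Finset (Tile v × Fin k))) : Set (Set (Tile v)) :=
  {T | IsTiling v T ∧ ∃ c : T → Fin k, ∀ P ∈ F, ¬ ColoredOccurs P T c}

/-- The three types of local rules. -/
inductive RuleType : Type
  | weakened
  | weak
  | strong

/-- The bound on the thickness of the tilings which have to exist. -/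
def RuleType.existenceThickness : RuleType → ℕ → ℕ
  | weakened, t => t
  | weak, _ => 1
  | strong, _ => 1

/-- The bound on the thickness of all the tilings. -/
def RuleType.uniformThickness : RuleType → ℕ → ℕ
  | weakened, t => t
  | weak, t => t
  | strong, _ => 1

/-- The set of tilings `X` enforces the set of planes `𝓔`, with thickness `t`. -/
def Enforces (ρ : RuleType) (t : ℕ) (X : Set (Set (Tile v))) (𝓔 : Set (Plane d n)) : Prop :=
  (∀ E ∈ 𝓔, ∃ T ∈ X, IsPlanar T E (ρ.existenceThickness t)) ∧
    ∀ T ∈ X, ∃ E ∈ 𝓔, IsPlanar T E (ρ.uniformThickness t)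

variable (v)

/-- `𝓔` admits (uncolored) local rules of type `ρ`. -/
def AdmitsLocalRules (ρ : RuleType) (𝓔 : Set (Plane d n)) : Prop :=
  ∃ F : Finset (Finset (Tile v)), ∃ t : ℕ, 1 ≤ t ∧ Enforces ρ t (tilingSpace F) 𝓔

/-- `𝓔` admits colored local rules of type `ρ`. -/
def AdmitsColoredLocalRules (ρ : RuleType) (𝓔 : Set (Plane d n)) : Prop :=
  ∃ k : ℕ, ∃ F : Finset (Finset (Tile v × Fin k)), ∃ t : ℕ, 1 ≤ t ∧
    Enforces ρ t (coloredTilingSpace F) 𝓔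

/-! ## Computability on the space of planes -/

/-- The metric on the space of `d`-planes. -/
def planeDist (E F : Plane d n) : ℝ :=
  max (sSup ((fun x => Metric.infDist x (F.1 : Set (EuclideanSpace ℝ (Fin n)))) ''
        ((E.1 : Set (EuclideanSpace ℝ (Fin n))) ∩ Metric.sphere 0 1)))
      (sSup ((fun x => Metric.infDist x (E.1 : Set (EuclideanSpace ℝ (Fin n)))) ''
        ((F.1 : Set (EuclideanSpace ℝ (Fin n))) ∩ Metric.sphere 0 1)))

/-- Rational numbers, as objects handled by algorithms, are coded as `(a - b) / (c + 1)`. -/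
def ratOfCode (a : ℕ × ℕ × ℕ) : ℚ := ((a.1 : ℚ) - a.2.1) / (a.2.2 + 1)

theorem ratOfCode_surjective : Function.Surjective ratOfCode := by
  intro q
  refine ⟨(q.num.toNat, (-q.num).toNat, q.den - 1), ?_⟩
  have h1 : ((q.num.toNat : ℚ) - ((-q.num).toNat : ℚ)) = q.num := by
    exact_mod_cast Int.toNat_sub_toNat_neg q.num
  have h2 : (((q.den - 1 : ℕ) : ℚ) + 1) = q.den := by
    exact_mod_cast Nat.sub_add_cancel q.den_pos
  simp only [ratOfCode, h1, h2]
  exact Rat.num_div_den q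

/-- Rational planes, as objects handled by algorithms, are coded by `d` generating vectors with
rational entries: `M` is a code of the `d`-plane `E`. -/
def IsPlaneCode (M : Fin d → Fin n → ℕ × ℕ × ℕ) (E : Plane d n) : Prop :=
  E.1 = Submodule.span ℝ (range fun i : Fin d =>
    (WithLp.toLp 2 fun j : Fin n => ((ratOfCode (M i j) : ℚ) : ℝ) : EuclideanSpace ℝ (Fin n)))

/-- `A` is recursively open: an algorithm outputs infinite sequences of rational planes and of
rational numbers such that `A` is the union of the corresponding open balls (a ball whose radius is
not positive is empty, so that the empty set is recursively open). -/
def RecursivelyOpen (A : Set (Plane d n)) : Prop :=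
  ∃ (q : ℕ → Fin d → Fin n → ℕ × ℕ × ℕ) (r : ℕ → ℕ × ℕ × ℕ) (F : ℕ → Plane d n),
    Computable q ∧ Computable r ∧ (∀ k, IsPlaneCode (q k) (F k)) ∧
      A = ⋃ k, {G | planeDist G (F k) < ((ratOfCode (r k) : ℚ) : ℝ)}

/-- `A` is recursively closed: its complement is recursively open. -/
def RecursivelyClosed (A : Set (Plane d n)) : Prop := RecursivelyOpen Aᶜ

/-- `E` is computable: an algorithm outputs, for any `m`, a rational plane within `1 / (m + 1)`
of `E`. -/
def ComputablePlane (E : Plane d n) : Prop :=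
  ∃ (q : ℕ → Fin d → Fin n → ℕ × ℕ × ℕ) (F : ℕ → Plane d n),
    Computable q ∧ (∀ m, IsPlaneCode (q m) (F m)) ∧
      ∀ m : ℕ, planeDist (F m) E ≤ 1 / ((m : ℝ) + 1)

end PlanarTilings

end

/-!
Every type of local rules reduces to colored rules that enforce a thickness `t` both for the
existence of tilings and for all tilings (`Enforces.weakened`, `exists_coloredTilingSpace_eq`). A lifted
colored tiling is a configuration on `ℤ^n`: at each point, which lifted tiles have their base there,
and with which colors. The vectors `v i` need not be computable, so no geometry can be decided by an
algorithm. Instead, the finite set of windows of a fixed radius `C` that occur in the lifts of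
allowed tilings is part of the algorithm, and so is the finite set of values of a configuration.

The algorithm tests rational planes `q`, given by matrices with an identity block (every plane has
such a matrix with entries in `[-1, 1]`, `exists_isReduced`). At scale `R` it searches all
configurations on the box `[-R, R]^n` that have a tile at the origin, only show windows of the list,
and stay within a fixed distance of `q`; this is decidable (`primrecPred_hasConfig`). If there is
none, then the ball of radius `1 / (n R + 1)` around `q` contains no slope of `𝓔`, because the lift
of a tiling of such a slope would be a configuration of this kind (`exists_boxConfig`).

Conversely, if configurations exist at all scales near planes that converge to `E`, compactness
gives a configuration on `ℤ^n` near `E` (`exists_limit_config`). When `E` is transverse to the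
kernel of the projection `ℝ^n → ℝ^d`, with a fixed constant, two lifted tiles near `E` whose
projections are close are themselves close, so that a large enough radius `C` makes all the
requirements local: the projection is a tiling, it has a lift near `E`, and no forbidden patch
occurs (`GoodConfig.exists_tiling`). This tiling has a slope in `𝓔`, and slopes are unique
(`IsTiling.plane_eq`), so `E ∈ 𝓔` (`exists_window`).

The constant exists because lifts are Lipschitz at large scale, uniformly over all tilings
(`exists_lift_bound`): a ball meets boundedly many tiles, and intersecting tiles share a vertex.
Hence all slopes of planar tilings are uniformly transverse to the kernel (`exists_slope_bound`), and the
planes that are not are covered by finitely many rational balls which avoid `𝓔`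
(`Enforces.recursivelyClosed`). If `𝓔` is a single plane, its matrix is computed by searching for a
scale at which all rational matrices in a small neighborhood that pass the test are close to each
other; such a scale exists by the same compactness argument (`Enforces.computablePlane`).
-/

noncomputable section

namespace PlanarTilings

/-! ### Closure properties of primitive recursive predicates -/

section Primrec

variable {α : Type*} [Primcodable α]

theorem primrec_sum {m : ℕ} {f : Fin m → α → ℕ} (hf : ∀ i, Primrec (f i)) :
    Primrec fun a => ∑ i, f i a := by
  induction m with
  | zero => simpa using Primrec.const 0
  | succ m ih =>
    simp only [Fin.sum_univ_succ]
    exact Primrec.nat_add.comp (hf 0) (ih fun i => hf i.succ)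

theorem primrec_pow {f g : α → ℕ} (hf : Primrec f) (hg : Primrec g) :
    Primrec fun a => f a ^ g a :=
  (Primrec₂.unpaired'.1 Nat.Primrec.pow).comp hf hg

theorem primrecPred_const (p : Prop) : PrimrecPred fun _ : α => p := by
  classical
  exact Primrec.primrecPred (Primrec.const (decide p))

theorem primrecPred_forall_fin {m : ℕ} {p : Fin m → α → Prop} (hp : ∀ i, PrimrecPred (p i)) :
    PrimrecPred fun a => ∀ i, p i a := by
  induction m with
  | zero => simpa using primrecPred_const (α := α) True
  | succ m ih =>
    simp only [Fin.forall_fin_succ]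
    exact (hp 0).and (ih fun i => hp i.succ)

theorem primrecPred_forall_finite {ι : Type*} [Finite ι] {p : ι → α → Prop}
    (hp : ∀ i, PrimrecPred (p i)) : PrimrecPred fun a => ∀ i, p i a := by
  obtain ⟨m, ⟨e⟩⟩ := Finite.exists_equiv_fin ι
  refine (primrecPred_forall_fin fun i => hp (e.symm i)).of_eq fun a => ?_
  exact ⟨fun h i => by simpa using h (e i), fun h i => h _⟩

theorem primrecPred_exists_finite {ι : Type*} [Finite ι] {p : ι → α → Prop}
    (hp : ∀ i, PrimrecPred (p i)) : PrimrecPred fun a => ∃ i, p i a :=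
  (primrecPred_forall_finite fun i => (hp i).not).not.of_eq fun a => by simp

theorem primrecPred_forall_lt {g : α → ℕ} {p : α → ℕ → Prop} (hg : Primrec g)
    (hp : PrimrecPred fun x : α × ℕ => p x.1 x.2) : PrimrecPred fun a => ∀ x < g a, p a x :=
  ((PrimrecRel.forall_mem_list (R := fun x a => p a x)
    (PrimrecPred.primrecRel (p := fun y : ℕ × α => p y.2 y.1)
      (hp.comp (Primrec.snd.pair Primrec.fst)))).comp
        (Primrec.list_range.comp hg) Primrec.id).of_eq fun a => by simp

theorem primrec_fin_arrow {σ : Type*} [Primcodable σ] {m : ℕ} {f : α → Fin m → σ}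
    (hf : ∀ i, Primrec fun a => f a i) : Primrec f := by
  refine Primrec.fin_curry.2 ?_
  exact ((Primrec.fin_curry₁ (f := fun i a => f a i)).2 hf).swap

theorem computable_nat_find {p : ℕ → ℕ → Prop} [∀ m, DecidablePred (p m)]
    (hp : PrimrecPred fun x : ℕ × ℕ => p x.1 x.2) (h : ∀ m, ∃ s, p m s) :
    Computable fun m => Nat.find (h m) := by
  have h1 : Computable₂ fun m s => decide (p m s) := by
    have := hp.decide
    exact this.to_comp
  refine (Partrec.rfind h1.partrec₂).of_eq fun m => ?_
  refine Part.eq_some_iff.2 (Nat.mem_rfind.2 ⟨?_, fun {s} hs => ?_⟩)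
  · simpa using Nat.find_spec (h m)
  · simpa using Nat.find_min (h m) hs

end Primrec

/-! ### Geometry of a single tile -/

section TileGeometry

variable {n d : ℕ} {v : Fin n → Fin d → ℝ}

theorem isCompact_parallelotope (v : Fin n → Fin d → ℝ) (p : Fin d → ℝ) (I : Finset (Fin n)) :
    IsCompact (parallelotope v p I) := by
  have h : parallelotope v p I =
      (fun c : Fin n → ℝ => p + ∑ i ∈ I, c i • v i) '' (Set.pi univ fun _ => Icc (0 : ℝ) 1) := by
    ext x
    constructor
    · rintro ⟨c, hc, rfl⟩
      exact ⟨c, fun i _ => hc i, rfl⟩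
    · rintro ⟨c, hc, rfl⟩
      exact ⟨c, fun i => hc i (mem_univ i), rfl⟩
  rw [h]
  exact (isCompact_univ_pi fun _ => isCompact_Icc).image (by fun_prop)

theorem base_mem_parallelotope (p : Fin d → ℝ) (I : Finset (Fin n)) :
    p ∈ parallelotope v p I := ⟨0, by simp, by simp⟩

theorem parallelotope_add (p u : Fin d → ℝ) (I : Finset (Fin n)) {x : Fin d → ℝ} :
    x + u ∈ parallelotope v (p + u) I ↔ x ∈ parallelotope v p I := by
  constructor
  · rintro ⟨c, hc, h⟩
    exact ⟨c, hc, by rw [add_right_comm] at h; exact add_right_cancel h⟩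
  · rintro ⟨c, hc, rfl⟩
    exact ⟨c, hc, by rw [add_right_comm]⟩

/-- A base point of a parallelotope with independent generators is an extreme point, hence it is
a vertex of any other description of the same parallelotope. -/
theorem exists_vertex_of_parallelotope_eq {p q : Fin d → ℝ} {I J : Finset (Fin n)}
    (hI : LinearIndependent ℝ fun i : I => v i) (hJ : LinearIndependent ℝ fun i : J => v i)
    (h : parallelotope v p I = parallelotope v q J) :
    ∃ S ⊆ J, p = q + ∑ i ∈ S, v i := by
  classical
  obtain ⟨c, hc, hp⟩ := h ▸ base_mem_parallelotope (v := v) p I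
  have key : ∀ i ∈ J, c i = 0 ∨ c i = 1 := by
    intro i hi
    by_contra hne
    push Not at hne
    have h0 : 0 < c i := lt_of_le_of_ne (hc i).1 (Ne.symm hne.1)
    have h1 : c i < 1 := lt_of_le_of_ne (hc i).2 hne.2
    -- moving by `±ε v i` stays inside, against extremality
    set ε := min (c i) (1 - c i) with hε
    have hε0 : 0 < ε := lt_min h0 (by linarith)
    have hεc : ε ≤ c i := min_le_left _ _
    have hεc' : ε ≤ 1 - c i := min_le_right _ _
    have move : ∀ s : ℝ, |s| ≤ ε → p + s • v i ∈ parallelotope v q J := by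
      intro s hs
      obtain ⟨hs1, hs2⟩ := abs_le.1 hs
      refine ⟨Function.update c i (c i + s), fun j => ?_, ?_⟩
      · by_cases hj : j = i
        · subst hj
          simp only [Function.update_self]
          exact ⟨by linarith, by linarith⟩
        · simpa [hj] using hc j
      · rw [hp, add_assoc]
        congr 1
        rw [← Finset.add_sum_erase J _ hi, ← Finset.add_sum_erase J _ hi]
        have : ∑ x ∈ J.erase i, Function.update c i (c i + s) x • v x =
            ∑ x ∈ J.erase i, c x • v x :=
          Finset.sum_congr rfl fun x hx => by
            rw [Function.update_of_ne (Finset.ne_of_mem_erase hx)]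
        rw [this, Function.update_self, add_smul]
        abel
    obtain ⟨a, ha, hpa⟩ := h ▸ move ε (by rw [abs_of_pos hε0])
    obtain ⟨b, hb, hpb⟩ := h ▸ move (-ε) (by rw [abs_neg, abs_of_pos hε0])
    have ea : ε • v i = ∑ j ∈ I, a j • v j := add_left_cancel hpa
    have eb : (-ε) • v i = ∑ j ∈ I, b j • v j := add_left_cancel hpb
    have hz : ∑ j ∈ I, (a j + b j) • v j = 0 := by
      simp only [add_smul, Finset.sum_add_distrib]
      rw [← ea, ← eb]
      simp
    have hz' := linearIndepOn_finset_iff.1 (show LinearIndepOn ℝ v (I : Set (Fin n)) from hI) _ hz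
    have : ε • v i = 0 := by
      rw [ea]
      refine Finset.sum_eq_zero fun j hj => ?_
      have := hz' j hj
      have : a j = 0 := by linarith [(ha j).1, (hb j).1]
      rw [this, zero_smul]
    have hv : v i ≠ 0 := hJ.ne_zero ⟨i, hi⟩
    exact (smul_ne_zero hε0.ne' hv) this
  refine ⟨J.filter fun i => c i = 1, Finset.filter_subset _ _, ?_⟩
  rw [hp]
  congr 1
  rw [Finset.sum_filter]
  refine Finset.sum_congr rfl fun i hi => ?_
  rcases key i hi with h0 | h1
  · simp [h0]
  · simp [h1]

/-- A bound for the diameter of all tiles. -/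
def diamBound (v : Fin n → Fin d → ℝ) : ℝ := ∑ i, ‖v i‖

theorem diamBound_nonneg (v : Fin n → Fin d → ℝ) : 0 ≤ diamBound v :=
  Finset.sum_nonneg fun _ _ => norm_nonneg _

namespace Tile

theorem isCompact_support (τ : Tile v) : IsCompact τ.support := isCompact_parallelotope _ _ _

theorem norm_sub_base_le {τ : Tile v} {x : Fin d → ℝ} (hx : x ∈ τ.support) :
    ‖x - τ.base‖ ≤ diamBound v := by
  obtain ⟨c, hc, rfl⟩ := hx
  rw [add_sub_cancel_left]
  calc ‖∑ i ∈ τ.dirs, c i • v i‖ ≤ ∑ i ∈ τ.dirs, ‖c i • v i‖ := norm_sum_le _ _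
    _ ≤ ∑ i ∈ τ.dirs, ‖v i‖ := Finset.sum_le_sum fun i _ => by
        rw [norm_smul, Real.norm_of_nonneg (hc i).1]
        exact mul_le_of_le_one_left (norm_nonneg _) (hc i).2
    _ ≤ diamBound v := Finset.sum_le_sum_of_subset_of_nonneg (Finset.subset_univ _)
        fun _ _ _ => norm_nonneg _

theorem base_mem_support (τ : Tile v) : τ.base ∈ τ.support := base_mem_parallelotope _ _

theorem vertex_mem_support (τ : Tile v) {S : Finset (Fin n)} (hS : S ⊆ τ.dirs) :
    τ.vertex S ∈ τ.support := by
  classical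
  refine ⟨fun i => if i ∈ S then 1 else 0, fun i => ?_, ?_⟩
  · dsimp only
    split_ifs <;> simp
  · simp only [vertex, ite_smul, one_smul, zero_smul]
    rw [← Finset.sum_filter, Finset.filter_mem_eq_inter, Finset.inter_eq_right.2 hS]

theorem vertex_empty (τ : Tile v) : τ.vertex ∅ = τ.base := by simp [vertex]

theorem mem_support_translate {τ : Tile v} {u x : Fin d → ℝ} :
    x + u ∈ (τ.translate u).support ↔ x ∈ τ.support := parallelotope_add _ _ _

theorem translate_translate (τ : Tile v) (u w : Fin d → ℝ) :
    (τ.translate u).translate w = τ.translate (u + w) := by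
  simp [translate, add_assoc]

theorem translate_injective (u : Fin d → ℝ) : Function.Injective (translate (v := v) u) := by
  intro τ σ h
  have h1 := congrArg base h
  have h2 := congrArg dirs h
  ext1
  · exact add_right_cancel h1
  · exact h2

theorem vertex_translate (τ : Tile v) (u : Fin d → ℝ) (S : Finset (Fin n)) :
    (τ.translate u).vertex S = τ.vertex S + u := by
  simp only [vertex, translate]
  abel

theorem coeff_eq_zero (τ : Tile v) {c : Fin n → ℝ} (h : ∑ i ∈ τ.dirs, c i • v i = 0) :
    ∀ i ∈ τ.dirs, c i = 0 :=
  linearIndepOn_finset_iff.1 (show LinearIndepOn ℝ v (τ.dirs : Set (Fin n)) from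
    τ.linearIndependent) c h

/-- The center of a tile. -/
def center (τ : Tile v) : Fin d → ℝ := τ.base + ∑ i ∈ τ.dirs, (1 / 2 : ℝ) • v i

theorem center_mem_support (τ : Tile v) : τ.center ∈ τ.support :=
  ⟨fun _ => 1 / 2, fun _ => ⟨by norm_num, by norm_num⟩, rfl⟩

theorem notMem_properFace (τ : Tile v) {c : Fin n → ℝ} (hc : ∀ i, c i ∈ Ioo (0 : ℝ) 1)
    {f : Set (Fin d → ℝ)} (hf : f ∈ τ.properFaces) : τ.base + ∑ i ∈ τ.dirs, c i • v i ∉ f := by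
  classical
  obtain ⟨A, B, hA, hB, -, rfl⟩ := hf
  rintro ⟨a, -, h⟩
  obtain ⟨i, hi, hiB⟩ := Finset.exists_of_ssubset hB
  rw [vertex, add_assoc] at h
  have h := add_left_cancel h
  have hz : ∑ j ∈ τ.dirs, (c j - (if j ∈ A then 1 else 0) - (if j ∈ B then a j else 0)) • v j
      = 0 := by
    simp only [sub_smul, Finset.sum_sub_distrib, ite_smul, one_smul, zero_smul]
    rw [← Finset.sum_filter, ← Finset.sum_filter, Finset.filter_mem_eq_inter,
      Finset.filter_mem_eq_inter, Finset.inter_eq_right.2 hA, Finset.inter_eq_right.2 hB.subset, h]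
    abel
  have := τ.coeff_eq_zero hz i hi
  have h1 := (hc i).1
  have h2 := (hc i).2
  simp only [hiB, if_false] at this
  split_ifs at this <;> linarith

end Tile

theorem exists_radius_coeff {I : Finset (Fin n)} (hcard : I.card = d)
    (hI : LinearIndependent ℝ fun i : I => v i) :
    ∃ r > 0, ∀ x : Fin d → ℝ, ‖x‖ < r →
      ∃ c : Fin n → ℝ, (∀ i, |c i| < 1 / 2) ∧ x = ∑ i ∈ I, c i • v i := by
  classical
  have hspan : Submodule.span ℝ (range fun i : I => v i) = ⊤ :=
    hI.span_eq_top_of_card_eq_finrank' (by simp [hcard])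
  let b := Module.Basis.mk hI hspan.ge
  have hcont : Continuous fun x : Fin d → ℝ => b.equivFun x :=
    LinearMap.continuous_of_finiteDimensional b.equivFun.toLinearMap
  have hopen := Metric.continuous_iff.1 hcont 0 (1 / 2) (by norm_num)
  obtain ⟨r, hr, h⟩ := hopen
  refine ⟨r, hr, fun x hx => ?_⟩
  have hx' := h x (by simpa using hx)
  rw [map_zero, dist_zero_right] at hx'
  refine ⟨fun i => if hi : i ∈ I then b.equivFun x ⟨i, hi⟩ else 0, fun i => ?_, ?_⟩
  · dsimp only
    split_ifs with hi
    · exact (norm_le_pi_norm (b.equivFun x) ⟨i, hi⟩).trans_lt hx'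
    · norm_num
  · conv_lhs => rw [← b.sum_equivFun x]
    rw [← Finset.sum_coe_sort I]
    refine Finset.sum_congr rfl fun i _ => ?_
    simp [b]

/-- All tiles contain, in their interior, a ball of the same radius around their center. -/
theorem exists_radius_center (v : Fin n → Fin d → ℝ) :
    ∃ r > 0, ∀ τ : Tile v, ∀ x, ‖x - τ.center‖ < r →
      ∃ c : Fin n → ℝ, (∀ i, c i ∈ Ioo (0 : ℝ) 1) ∧ x = τ.base + ∑ i ∈ τ.dirs, c i • v i := by
  classical
  have h : ∀ I : Finset (Fin n), ∃ r > 0, (∃ τ : Tile v, τ.dirs = I) →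
      ∀ x : Fin d → ℝ, ‖x‖ < r →
      ∃ c : Fin n → ℝ, (∀ i, |c i| < 1 / 2) ∧ x = ∑ i ∈ I, c i • v i := by
    intro I
    by_cases hI : ∃ τ : Tile v, τ.dirs = I
    · obtain ⟨τ, rfl⟩ := hI
      obtain ⟨r, hr, h⟩ := exists_radius_coeff τ.card_dirs τ.linearIndependent
      exact ⟨r, hr, fun _ => h⟩
    · exact ⟨1, one_pos, fun h => absurd h hI⟩
  choose r hr hr' using h
  obtain ⟨I₀, hI₀⟩ := Finite.exists_min r
  refine ⟨r I₀, hr I₀, fun τ x hx => ?_⟩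
  obtain ⟨c, hc, hx⟩ := hr' τ.dirs ⟨τ, rfl⟩ (x - τ.center) (hx.trans_le (hI₀ _))
  refine ⟨fun i => 1 / 2 + c i, fun i => ?_, ?_⟩
  · obtain ⟨h1, h2⟩ := abs_lt.1 (hc i)
    exact ⟨by linarith, by linarith⟩
  · rw [sub_eq_iff_eq_add] at hx
    simp only [add_smul, Finset.sum_add_distrib]
    rw [hx, Tile.center]
    abel

end TileGeometry

/-! ### Connectedness of tilings -/

section Tilings

variable {n d : ℕ} {v : Fin n → Fin d → ℝ} {T : Set (Tile v)}

theorem IsTiling.exists_mem (hT : IsTiling v T) (x : Fin d → ℝ) : ∃ τ ∈ T, x ∈ τ.support := by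
  have : x ∈ ⋃ τ ∈ T, τ.support := hT.covers ▸ mem_univ x
  simpa using this

/-- In a tiling, a ball of radius `1` meets a number of tiles which is bounded in terms of `v`:
the centers of distinct tiles are uniformly separated. -/
theorem exists_ncard_bound (v : Fin n → Fin d → ℝ) :
    ∃ N : ℕ, ∀ T : Set (Tile v), IsTiling v T → ∀ x : Fin d → ℝ,
      {τ ∈ T | (τ.support ∩ Metric.closedBall x 1).Nonempty}.Finite ∧
      {τ ∈ T | (τ.support ∩ Metric.closedBall x 1).Nonempty}.ncard ≤ N := by
  obtain ⟨r, hr, hrad⟩ := exists_radius_center v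
  obtain ⟨t, -, ht, hcover⟩ := (isCompact_closedBall (0 : Fin d → ℝ)
    (1 + 2 * diamBound v)).finite_cover_balls (half_pos hr)
  refine ⟨t.ncard, fun T hT x => ?_⟩
  have hc : ∀ τ ∈ {τ ∈ T | (τ.support ∩ Metric.closedBall x 1).Nonempty},
      ∃ y ∈ t, τ.center - x ∈ Metric.ball y (r / 2) := by
    rintro τ ⟨-, z, hz, hzx⟩
    have h1 := Tile.norm_sub_base_le hz
    have h2 := Tile.norm_sub_base_le τ.center_mem_support
    rw [mem_closedBall_iff_norm] at hzx
    have : τ.center - x ∈ Metric.closedBall (0 : Fin d → ℝ) (1 + 2 * diamBound v) := by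
      rw [mem_closedBall_zero_iff]
      calc ‖τ.center - x‖ = ‖(τ.center - τ.base) - (z - τ.base) + (z - x)‖ := by congr 1; abel
        _ ≤ ‖τ.center - τ.base‖ + ‖z - τ.base‖ + ‖z - x‖ :=
          (norm_add_le _ _).trans (by gcongr; exact norm_sub_le _ _)
        _ ≤ 1 + 2 * diamBound v := by linarith
    simpa using hcover this
  choose! f hft hf using hc
  have hmaps : MapsTo f {τ ∈ T | (τ.support ∩ Metric.closedBall x 1).Nonempty} t :=
    fun τ hτ => hft τ hτ
  have hinj : InjOn f {τ ∈ T | (τ.support ∩ Metric.closedBall x 1).Nonempty} := by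
    intro τ hτ σ hσ h
    by_contra hne
    have h1 := mem_ball_iff_norm.1 (hf τ hτ)
    have h2 := mem_ball_iff_norm.1 (hf σ hσ)
    rw [← h] at h2
    have hlt : ‖σ.center - τ.center‖ < r := by
      calc ‖σ.center - τ.center‖ = ‖(σ.center - x - f τ) - (τ.center - x - f τ)‖ := by
            congr 1; abel
        _ ≤ _ := norm_sub_le _ _
        _ < r := by linarith
    obtain ⟨c, hc, hcσ⟩ := hrad τ _ hlt
    have hmem : σ.center ∈ τ.support ∩ σ.support :=
      ⟨⟨c, fun i => Ioo_subset_Icc_self (hc i), hcσ⟩, σ.center_mem_support⟩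
    rcases hT.faceToFace τ hτ.1 σ hσ.1 hne with h0 | h0
    · exact absurd hmem (h0 ▸ notMem_empty _)
    · exact τ.notMem_properFace hc h0.1 (hcσ ▸ hmem)
  exact ⟨ht.of_injOn hmaps hinj, ncard_le_ncard_of_injOn f hmaps hinj ht⟩

/-- An integer function on tiles which varies by at most `1` between intersecting tiles varies
boundedly on tiles at bounded distance: otherwise, by the pigeonhole principle, it misses a value
on the tiles that meet some ball, and cuts this ball into two disjoint closed parts. -/
theorem exists_variation_bound (v : Fin n → Fin d → ℝ) :
    ∃ K : ℕ, ∀ T : Set (Tile v), IsTiling v T → ∀ f : Tile v → ℤ,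
      (∀ τ ∈ T, ∀ σ ∈ T, (τ.support ∩ σ.support).Nonempty → |f τ - f σ| ≤ 1) →
      ∀ (N : ℕ) (τ) (_ : τ ∈ T) (σ) (_ : σ ∈ T) (x) (_ : x ∈ τ.support) (y) (_ : y ∈ σ.support),
        ‖x - y‖ ≤ N + 1 → |f τ - f σ| ≤ K * (N + 1) := by
  obtain ⟨N₀, hN₀⟩ := exists_ncard_bound v
  refine ⟨N₀ + 1, fun T hT f hf => ?_⟩
  have step : ∀ τ ∈ T, ∀ σ ∈ T, ∀ x, (τ.support ∩ Metric.closedBall x 1).Nonempty →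
      (σ.support ∩ Metric.closedBall x 1).Nonempty → f σ - f τ ≤ N₀ + 1 := by
    intro τ₀ hτ₀ σ₀ hσ₀ x hx hy
    by_contra! hlt
    obtain ⟨hfin, hcard⟩ := hN₀ T hT x
    set B := {τ ∈ T | (τ.support ∩ Metric.closedBall x 1).Nonempty} with hB
    obtain ⟨m, hm, hmB⟩ : ∃ m ∈ Ioo (f τ₀) (f σ₀), m ∉ f '' B := by
      by_contra! hsub
      have h1 : (Ioo (f τ₀) (f σ₀)).ncard ≤ N₀ :=
        (ncard_le_ncard hsub (hfin.image f)).trans ((ncard_image_le hfin).trans hcard)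
      rw [← Finset.coe_Ioo, ncard_coe_finset, Int.card_Ioo] at h1
      omega
    have hclosed : ∀ p : Tile v → Prop, IsClosed (⋃ τ ∈ {τ ∈ B | p τ}, τ.support) := fun p =>
      (hfin.subset (sep_subset _ _)).isClosed_biUnion fun τ _ => τ.isCompact_support.isClosed
    have hpre := isPreconnected_closed_iff.1 (convex_closedBall x (1 : ℝ)).isPreconnected _ _
      (hclosed fun τ => f τ < m) (hclosed fun τ => m < f τ)
    obtain ⟨z, -, hz1, hz2⟩ := hpre
      (by
        intro z hz
        obtain ⟨τ, hτ, hzτ⟩ := hT.exists_mem z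
        have hτB : τ ∈ B := ⟨hτ, z, hzτ, hz⟩
        rcases lt_trichotomy (f τ) m with h | h | h
        · exact Or.inl (mem_biUnion (show τ ∈ {τ ∈ B | f τ < m} from ⟨hτB, h⟩) hzτ)
        · exact absurd ⟨τ, hτB, h⟩ hmB
        · exact Or.inr (mem_biUnion (show τ ∈ {τ ∈ B | m < f τ} from ⟨hτB, h⟩) hzτ))
      (by
        obtain ⟨z, hz, hzx⟩ := hx
        exact ⟨z, hzx, mem_biUnion (show τ₀ ∈ {τ ∈ B | f τ < m} from
          ⟨⟨hτ₀, z, hz, hzx⟩, hm.1⟩) hz⟩)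
      (by
        obtain ⟨z, hz, hzx⟩ := hy
        exact ⟨z, hzx, mem_biUnion (show σ₀ ∈ {τ ∈ B | m < f τ} from
          ⟨⟨hσ₀, z, hz, hzx⟩, hm.2⟩) hz⟩)
    simp only [mem_iUnion, exists_prop] at hz1 hz2
    obtain ⟨τ, ⟨hτ, hτm⟩, hzτ⟩ := hz1
    obtain ⟨σ, ⟨hσ, hσm⟩, hzσ⟩ := hz2
    have := abs_le.1 (hf τ hτ.1 σ hσ.1 ⟨z, hzτ, hzσ⟩)
    omega
  have step' : ∀ τ ∈ T, ∀ σ ∈ T, ∀ x ∈ τ.support, ∀ y ∈ σ.support, ‖x - y‖ ≤ 1 →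
      |f τ - f σ| ≤ N₀ + 1 := by
    intro τ hτ σ hσ x hx y hy hxy
    have h1 : (τ.support ∩ Metric.closedBall x 1).Nonempty :=
      ⟨x, hx, Metric.mem_closedBall_self zero_le_one⟩
    have h2 : (σ.support ∩ Metric.closedBall x 1).Nonempty :=
      ⟨y, hy, by rwa [mem_closedBall_iff_norm, norm_sub_rev]⟩
    have h3 := step τ hτ σ hσ x h1 h2
    have h4 := step σ hσ τ hτ x h2 h1
    exact abs_le.2 ⟨by linarith, by linarith⟩
  intro N
  induction N with
  | zero =>
    intro τ hτ σ hσ x hx y hy hxy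
    simpa using step' τ hτ σ hσ x hx y hy (by simpa using hxy)
  | succ N ih =>
    intro τ hτ σ hσ x hx y hy hxy
    push_cast at hxy ⊢
    set s : ℝ := 1 / (N + 2) with hs
    have hN : (0 : ℝ) < N + 2 := by positivity
    obtain ⟨ρ, hρ, hz⟩ := hT.exists_mem (x + s • (y - x))
    have h1 : ‖x - (x + s • (y - x))‖ ≤ 1 := by
      rw [sub_add_cancel_left, norm_neg, norm_smul, Real.norm_of_nonneg (by positivity),
        norm_sub_rev, hs, one_div_mul_eq_div, div_le_one hN]
      linarith
    have h2 : ‖(x + s • (y - x)) - y‖ ≤ N + 1 := by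
      have : (x + s • (y - x)) - y = (1 - s) • (x - y) := by
        simp only [sub_smul, smul_sub, one_smul]; abel
      have hs1 : 1 - s = (N + 1) / (N + 2) := by rw [hs]; field_simp; ring
      rw [this, norm_smul, hs1, Real.norm_of_nonneg (by positivity), div_mul_eq_mul_div,
        div_le_iff₀ hN]
      exact mul_le_mul_of_nonneg_left (by linarith) (by positivity)
    have h3 := step' τ hτ ρ hρ x hx _ hz h1
    have h4 := ih ρ hρ σ hσ _ hz y hy h2
    push_cast at h4
    calc |f τ - f σ| ≤ |f τ - f ρ| + |f ρ - f σ| := abs_sub_le _ _ _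
      _ ≤ (N₀ + 1) + (N₀ + 1) * (N + 1) := by linarith
      _ = (N₀ + 1) * (N + 1 + 1) := by ring

/-- A function on the tiles of a tiling is constant if it agrees on intersecting tiles. -/
theorem IsTiling.eq_of_locally_eq (hT : IsTiling v T) {β : Type*} (g : Tile v → β)
    (hg : ∀ τ ∈ T, ∀ σ ∈ T, (τ.support ∩ σ.support).Nonempty → g τ = g σ)
    {τ σ : Tile v} (hτ : τ ∈ T) (hσ : σ ∈ T) : g τ = g σ := by
  classical
  by_contra hne
  obtain ⟨K, hK⟩ := exists_variation_bound v
  obtain ⟨N, hN⟩ := exists_nat_ge ‖τ.base - σ.base‖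
  -- a two-valued function whose values are further apart than the variation bound
  have := hK T hT (fun ρ => if g ρ = g τ then 0 else (K * (N + 1) + 1 : ℤ))
    (fun ρ hρ ρ' hρ' h => by simp [hg ρ hρ ρ' hρ' h]) N τ hτ σ hσ _ τ.base_mem_support _
    σ.base_mem_support (by linarith)
  simp only [if_true, if_neg (Ne.symm hne), zero_sub, abs_neg] at this
  have := (le_abs_self _).trans this
  omega

/-! ### Lifts -/

/-- The linear map sending the canonical basis to the vectors `v i`. -/
def proj (v : Fin n → Fin d → ℝ) : EuclideanSpace ℝ (Fin n) →ₗ[ℝ] (Fin d → ℝ) where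
  toFun x := ∑ i, x i • v i
  map_add' x y := by simp [add_smul, Finset.sum_add_distrib]
  map_smul' c x := by simp [mul_smul, Finset.smul_sum]

theorem proj_apply (x : EuclideanSpace ℝ (Fin n)) : proj v x = ∑ i, x i • v i := rfl

/-- An integer vector, as an element of the Euclidean space. -/
def intVec (z : Fin n → ℤ) : EuclideanSpace ℝ (Fin n) := WithLp.toLp 2 fun i => (z i : ℝ)

@[simp] theorem intVec_apply (z : Fin n → ℤ) (i : Fin n) : intVec z i = z i := rfl

theorem intVec_sub (z w : Fin n → ℤ) : intVec (z - w) = intVec z - intVec w := by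
  ext i; simp [intVec]

theorem abs_apply_le_norm (x : EuclideanSpace ℝ (Fin n)) (i : Fin n) : |x i| ≤ ‖x‖ :=
  PiLp.norm_apply_le x i

theorem norm_le_of_abs_le {x : EuclideanSpace ℝ (Fin n)} {C : ℝ} (hC : 0 ≤ C)
    (h : ∀ i, |x i| ≤ C) : ‖x‖ ≤ n * C := by
  rw [EuclideanSpace.norm_eq]
  refine Real.sqrt_le_iff.2 ⟨by positivity, ?_⟩
  calc ∑ i, ‖x i‖ ^ 2 ≤ ∑ _i : Fin n, C ^ 2 :=
        Finset.sum_le_sum fun i _ => by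
          rw [Real.norm_eq_abs]
          exact pow_le_pow_left₀ (abs_nonneg _) (h i) 2
    _ = n * C ^ 2 := by simp
    _ ≤ (n * C) ^ 2 := by
      rw [mul_pow]
      refine mul_le_mul_of_nonneg_right ?_ (by positivity)
      exact_mod_cast Nat.le_self_pow two_ne_zero n

theorem norm_proj_le (x : EuclideanSpace ℝ (Fin n)) : ‖proj v x‖ ≤ diamBound v * ‖x‖ := by
  rw [proj_apply, diamBound, Finset.sum_mul]
  refine (norm_sum_le _ _).trans (Finset.sum_le_sum fun i _ => ?_)
  rw [norm_smul, mul_comm]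
  exact mul_le_mul_of_nonneg_left (abs_apply_le_norm x i) (norm_nonneg _)

/-- The integer indicator vector of a set of indices. -/
def indVec (S : Finset (Fin n)) : Fin n → ℤ := fun i => if i ∈ S then 1 else 0

theorem proj_indVec (S : Finset (Fin n)) : proj v (intVec (indVec S)) = ∑ i ∈ S, v i := by
  simp only [proj_apply, intVec_apply, indVec, Int.cast_ite, Int.cast_one, Int.cast_zero, ite_smul,
    one_smul, zero_smul]
  rw [← Finset.sum_filter]
  simp

theorem abs_indVec_sub_le (S S' : Finset (Fin n)) (j : Fin n) :
    |indVec S j - indVec S' j| ≤ 1 := by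
  unfold indVec
  split_ifs <;> simp

variable {L L' : (Fin d → ℝ) → Fin n → ℤ}

theorem IsLift.apply_vertex (hL : IsLift T L) {τ : Tile v} (hτ : τ ∈ T) {S : Finset (Fin n)}
    (hS : S ⊆ τ.dirs) : L (τ.vertex S) = L τ.base + indVec S := by
  classical
  induction S using Finset.induction_on with
  | empty =>
    rw [τ.vertex_empty]
    ext i
    simp [indVec]
  | insert i S hi ih =>
    have hS' : S ⊆ τ.dirs := (Finset.subset_insert i S).trans hS
    have h : τ.vertex (insert i S) = τ.vertex S + v i := by
      simp only [Tile.vertex, Finset.sum_insert hi]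
      abel
    rw [h, hL.2 τ hτ S hS' i (hS (Finset.mem_insert_self i S)) hi, ih hS', add_assoc]
    congr 1
    ext j
    by_cases hj : j = i
    · subst hj
      simp [indVec, hi]
    · simp [indVec, hj]

theorem IsTiling.exists_common_vertex (hT : IsTiling v T) {τ σ : Tile v} (hτ : τ ∈ T) (hσ : σ ∈ T)
    (h : (τ.support ∩ σ.support).Nonempty) :
    ∃ S ⊆ τ.dirs, ∃ S' ⊆ σ.dirs, τ.vertex S = σ.vertex S' := by
  classical
  by_cases hne : τ = σ
  · subst hne
    exact ⟨∅, Finset.empty_subset _, ∅, Finset.empty_subset _, rfl⟩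
  rcases hT.faceToFace τ hτ σ hσ hne with h0 | ⟨⟨A, B, hA, hB, -, hf⟩, A', B', hA', hB', hd, hf'⟩
  · exact absurd h0 h.ne_empty
  · have hli : ∀ {I J : Finset (Fin n)}, I ⊆ J → LinearIndependent ℝ (fun i : J => v i) →
        LinearIndependent ℝ fun i : I => v i := fun hIJ hJ =>
      LinearIndepOn.mono (v := v) (show LinearIndepOn ℝ v _ from hJ) (Finset.coe_subset.2 hIJ)
    obtain ⟨S, hS, hp⟩ := exists_vertex_of_parallelotope_eq (hli hB.subset τ.linearIndependent)
      (hli hB'.subset σ.linearIndependent) (hf.symm.trans hf')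
    refine ⟨A, hA, A' ∪ S, Finset.union_subset hA' (hS.trans hB'.subset), ?_⟩
    rw [hp, Tile.vertex, Tile.vertex,
      Finset.sum_union (Finset.disjoint_of_subset_right hS hd), add_assoc]

/-- Intersecting tiles share a vertex. So their bases differ by a difference of two sums of vectors
`v i`, and the lifts of their bases by the corresponding integer vector, the same for all lifts. -/
theorem IsLift.exists_indVec (hT : IsTiling v T) {τ σ : Tile v} (hτ : τ ∈ T) (hσ : σ ∈ T)
    (h : (τ.support ∩ σ.support).Nonempty) :
    ∃ S S' : Finset (Fin n), τ.base - σ.base = ∑ i ∈ S', v i - ∑ i ∈ S, v i ∧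
      ∀ L, IsLift T L → L τ.base - L σ.base = indVec S' - indVec S := by
  obtain ⟨S, hS, S', hS', he⟩ := hT.exists_common_vertex hτ hσ h
  refine ⟨S, S', ?_, fun L hL => ?_⟩
  · rw [sub_eq_sub_iff_add_eq_add, add_comm _ σ.base]
    exact he
  · rw [sub_eq_sub_iff_add_eq_add, add_comm _ (L σ.base), ← hL.apply_vertex hτ hS,
      ← hL.apply_vertex hσ hS', he]

/-- The projection of the lift of a tiling is the tiling, up to a translation. -/
theorem IsLift.base_sub_base (hL : IsLift T L) (hT : IsTiling v T) {τ σ : Tile v} (hτ : τ ∈ T)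
    (hσ : σ ∈ T) : τ.base - σ.base = proj v (intVec (L τ.base - L σ.base)) := by
  have := hT.eq_of_locally_eq (fun ρ : Tile v => ρ.base - proj v (intVec (L ρ.base)))
    (fun τ hτ σ hσ h => by
      obtain ⟨S, S', h1, h2⟩ := IsLift.exists_indVec hT hτ hσ h
      have h2 := congrArg (fun z => proj v (intVec z)) (h2 L hL)
      simp only [intVec_sub, map_sub, proj_indVec] at h2
      rw [← h1, sub_eq_sub_iff_add_eq_add] at h2
      rw [sub_eq_sub_iff_add_eq_add, ← h2, add_comm]) hτ hσ
  rw [intVec_sub, map_sub, ← sub_eq_zero] at *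
  rw [← this]
  abel

/-- The lift of a tiling is unique up to a translation. -/
theorem IsLift.sub_eq_sub (hL : IsLift T L) (hL' : IsLift T L') (hT : IsTiling v T) {τ σ : Tile v}
    (hτ : τ ∈ T) (hσ : σ ∈ T) : L τ.base - L σ.base = L' τ.base - L' σ.base := by
  have := hT.eq_of_locally_eq (fun ρ : Tile v => L ρ.base - L' ρ.base)
    (fun τ hτ σ hσ h => by
      obtain ⟨S, S', -, h2⟩ := IsLift.exists_indVec hT hτ hσ h
      have := (h2 L hL).trans (h2 L' hL').symm
      rw [sub_eq_sub_iff_add_eq_add] at this ⊢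
      rw [this, add_comm]) hτ hσ
  rw [sub_eq_sub_iff_add_eq_add] at this ⊢
  rw [this, add_comm]

/-- Lifts are Lipschitz at large scale, with a constant that depends only on `v`. -/
theorem exists_lift_bound (v : Fin n → Fin d → ℝ) :
    ∃ K : ℕ, ∀ T : Set (Tile v), IsTiling v T → ∀ L, IsLift T L →
      ∀ (N : ℕ) (τ) (_ : τ ∈ T) (σ) (_ : σ ∈ T) (x) (_ : x ∈ τ.support) (y) (_ : y ∈ σ.support),
        ‖x - y‖ ≤ N + 1 → ∀ j, |L τ.base j - L σ.base j| ≤ K * (N + 1) := by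
  obtain ⟨K, hK⟩ := exists_variation_bound v
  refine ⟨K, fun T hT L hL N τ hτ σ hσ x hx y hy h j => ?_⟩
  refine hK T hT (fun ρ => L ρ.base j) (fun τ hτ σ hσ h => ?_) N τ hτ σ hσ x hx y hy h
  obtain ⟨S, S', -, h2⟩ := IsLift.exists_indVec hT hτ hσ h
  have := congrFun (h2 L hL) j
  simp only [Pi.sub_apply] at this
  rw [this]
  exact abs_indVec_sub_le _ _ _

/-! ### Slopes -/

/-- The differences between the lifts of the base points of tiles are at distance at most `D` from
`E`. -/
def NearPlane (T : Set (Tile v)) (L : (Fin d → ℝ) → Fin n → ℤ)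
    (E : Submodule ℝ (EuclideanSpace ℝ (Fin n))) (D : ℝ) : Prop :=
  ∀ τ ∈ T, ∀ σ ∈ T, ∃ y ∈ E, ‖intVec (L τ.base - L σ.base) - y‖ ≤ D

theorem IsPlanar.exists_nearPlane {E : Plane d n} {t : ℕ} (h : IsPlanar T E t) :
    ∃ L, IsLift T L ∧ NearPlane T L E.1 (n * t) := by
  obtain ⟨A, hA, L, hL, hsub⟩ := h
  refine ⟨L, hL, fun τ hτ σ hσ => ?_⟩
  have hmem : ∀ τ ∈ T, intVec (L τ.base) ∈ liftSet T L := fun τ hτ =>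
    ⟨τ, hτ, fun i => ⟨fun _ => by simp, fun _ => rfl⟩⟩
  obtain ⟨a, ha, haτ⟩ := hsub (hmem τ hτ)
  obtain ⟨b, hb, hbσ⟩ := hsub (hmem σ hσ)
  refine ⟨a - b, ?_, norm_le_of_abs_le (Nat.cast_nonneg t) fun i => ?_⟩
  · rw [← hA]
    exact AffineSubspace.vsub_mem_direction ha hb
  · have h1 := haτ i
    have h2 := hbσ i
    simp only [intVec_apply, mem_Icc] at h1 h2
    simp only [intVec_sub, PiLp.sub_apply, intVec_apply]
    exact abs_le.2 ⟨by linarith [h1.1, h2.2], by linarith [h1.2, h2.1]⟩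

theorem norm_base_sub_base_sub_le {τ σ : Tile v} {x y : Fin d → ℝ} (hx : x ∈ τ.support)
    (hy : y ∈ σ.support) : ‖(τ.base - σ.base) - (x - y)‖ ≤ 2 * diamBound v := by
  have h1 := Tile.norm_sub_base_le hx
  have h2 := Tile.norm_sub_base_le hy
  calc ‖(τ.base - σ.base) - (x - y)‖ = ‖(y - σ.base) - (x - τ.base)‖ := by congr 1; abel
    _ ≤ _ := norm_sub_le _ _
    _ ≤ 2 * diamBound v := by linarith

open Filter Topology in
/-- The slopes of planar tilings are uniformly transverse to the kernel of the projection. -/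
theorem exists_slope_bound (v : Fin n → Fin d → ℝ) :
    ∃ c : ℝ, 0 < c ∧ ∀ T : Set (Tile v), IsTiling v T → ∀ L, IsLift T L → ∀ (E : Plane d n) (D : ℝ),
      NearPlane T L E.1 D → ∀ y ∈ E.1, ‖y‖ ≤ c * ‖proj v y‖ := by
  obtain ⟨K, hK⟩ := exists_lift_bound v
  refine ⟨n * K + 1, by positivity, fun T hT L hL E D hE => ?_⟩
  -- going far in the direction `u` in the tiling, one finds a preimage of `u` in `E`
  have key : ∀ u : Fin d → ℝ, ∃ w ∈ E.1, ‖w‖ ≤ n * K * ‖u‖ ∧ proj v w = u := by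
    intro u
    have h : ∀ N : ℕ, ∃ y ∈ E.1, ‖y‖ ≤ n * (K * (N * ‖u‖ + 2)) + D ∧
        ‖proj v y - (N : ℝ) • u‖ ≤ diamBound v * D + 2 * diamBound v := by
      intro N
      obtain ⟨τ, hτ, hxτ⟩ := hT.exists_mem ((N : ℝ) • u)
      obtain ⟨σ, hσ, hxσ⟩ := hT.exists_mem 0
      obtain ⟨y, hy, hyz⟩ := hE τ hτ σ hσ
      have hu : ‖(N : ℝ) • u - 0‖ = N * ‖u‖ := by
        rw [sub_zero, norm_smul, Real.norm_of_nonneg (Nat.cast_nonneg N)]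
      have h1 := hK T hT L hL ⌈(N : ℝ) * ‖u‖⌉₊ τ hτ σ hσ _ hxτ _ hxσ
        (by rw [hu]; linarith [Nat.le_ceil ((N : ℝ) * ‖u‖)])
      have h2 : ‖intVec (L τ.base - L σ.base)‖ ≤ n * (K * (N * ‖u‖ + 2)) := by
        refine norm_le_of_abs_le (by positivity) fun j => ?_
        have h3 : |((L τ.base j - L σ.base j : ℤ) : ℝ)| ≤ K * (⌈(N : ℝ) * ‖u‖⌉₊ + 1) := by
          exact_mod_cast h1 j
        refine h3.trans (mul_le_mul_of_nonneg_left ?_ (Nat.cast_nonneg K))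
        have := (Nat.ceil_lt_add_one (by positivity : 0 ≤ (N : ℝ) * ‖u‖)).le
        linarith
      refine ⟨y, hy, ?_, ?_⟩
      · calc ‖y‖ = ‖intVec (L τ.base - L σ.base) - (intVec (L τ.base - L σ.base) - y)‖ := by
              congr 1; abel
          _ ≤ _ := norm_sub_le _ _
          _ ≤ _ := by linarith
      · have h4 := norm_base_sub_base_sub_le hxτ hxσ
        rw [hL.base_sub_base hT hτ hσ, sub_zero] at h4
        have h5 : ‖proj v (intVec (L τ.base - L σ.base) - y)‖ ≤ diamBound v * D :=
          (norm_proj_le _).trans (mul_le_mul_of_nonneg_left hyz (diamBound_nonneg v))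
        rw [map_sub] at h5
        calc ‖proj v y - (N : ℝ) • u‖ = ‖(proj v (intVec (L τ.base - L σ.base)) - (N : ℝ) • u) -
              (proj v (intVec (L τ.base - L σ.base)) - proj v y)‖ := by congr 1; abel
          _ ≤ _ := norm_sub_le _ _
          _ ≤ _ := by linarith
    choose y hyE hy1 hy2 using h
    have hD : 0 ≤ D := by
      obtain ⟨σ, hσ, -⟩ := hT.exists_mem 0
      obtain ⟨y, -, hy⟩ := hE σ hσ σ hσ
      exact (norm_nonneg _).trans hy
    have h0 := tendsto_one_div_add_atTop_nhds_zero_nat (𝕜 := ℝ)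
    have hw1 : ∀ N : ℕ, ‖(1 / ((N : ℝ) + 1)) • y (N + 1)‖ ≤
        n * K * ‖u‖ + (1 / ((N : ℝ) + 1)) * (n * K * 2 + D) := by
      intro N
      rw [norm_smul, Real.norm_of_nonneg (by positivity)]
      have hN : (0 : ℝ) < N + 1 := by positivity
      have := hy1 (N + 1)
      push_cast at this
      calc 1 / ((N : ℝ) + 1) * ‖y (N + 1)‖
          ≤ 1 / ((N : ℝ) + 1) * (n * (K * ((N + 1) * ‖u‖ + 2)) + D) := by gcongr
        _ = _ := by field_simp; ring
    have hw2 : ∀ N : ℕ, ‖proj v ((1 / ((N : ℝ) + 1)) • y (N + 1)) - u‖ ≤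
        (1 / ((N : ℝ) + 1)) * (diamBound v * D + 2 * diamBound v) := by
      intro N
      have hN : (0 : ℝ) < N + 1 := by positivity
      have := hy2 (N + 1)
      push_cast at this
      have he : proj v ((1 / ((N : ℝ) + 1)) • y (N + 1)) - u =
          (1 / ((N : ℝ) + 1)) • (proj v (y (N + 1)) - ((N : ℝ) + 1) • u) := by
        rw [map_smul, smul_sub, smul_smul, one_div_mul_cancel hN.ne', one_smul]
      rw [he, norm_smul, Real.norm_of_nonneg (by positivity)]
      gcongr
    have hball : ∀ N : ℕ, (1 / ((N : ℝ) + 1)) • y (N + 1) ∈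
        Metric.closedBall (0 : EuclideanSpace ℝ (Fin n)) (n * K * ‖u‖ + (n * K * 2 + D)) := by
      intro N
      rw [mem_closedBall_zero_iff]
      refine (hw1 N).trans ?_
      have : 1 / ((N : ℝ) + 1) ≤ 1 := by
        rw [div_le_one (by positivity)]
        linarith [(Nat.cast_nonneg N : (0 : ℝ) ≤ N)]
      have hpos : 0 ≤ (n * K * 2 + D : ℝ) := by positivity
      nlinarith
    obtain ⟨w, -, φ, hφ, hlim⟩ := (isCompact_closedBall _ _).tendsto_subseq hball
    have h0φ := h0.comp hφ.tendsto_atTop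
    refine ⟨w, ?_, ?_, ?_⟩
    · refine (Submodule.closed_of_finiteDimensional E.1).mem_of_tendsto hlim
        (Eventually.of_forall fun N => ?_)
      exact E.1.smul_mem _ (hyE _)
    · have h8 : Tendsto (fun N => n * K * ‖u‖ + (1 / ((φ N : ℝ) + 1)) * (n * K * 2 + D)) atTop
          (𝓝 (n * K * ‖u‖ + 0 * (n * K * 2 + D))) :=
        tendsto_const_nhds.add (h0φ.mul_const (n * K * 2 + D : ℝ))
      have h9 := le_of_tendsto_of_tendsto hlim.norm h8 (Eventually.of_forall fun N => hw1 (φ N))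
      linarith
    · have hc : Continuous (proj v) := LinearMap.continuous_of_finiteDimensional _
      have h1 := (hc.tendsto w).comp hlim
      refine tendsto_nhds_unique h1 (tendsto_iff_norm_sub_tendsto_zero.2 ?_)
      refine squeeze_zero (fun _ => norm_nonneg _) (fun N => hw2 (φ N)) ?_
      simpa using h0φ.mul_const (diamBound v * D + 2 * diamBound v)
  have hsurj : Function.Surjective ((proj v).comp E.1.subtype) := fun u => by
    obtain ⟨w, hw, -, hu⟩ := key u
    exact ⟨⟨w, hw⟩, hu⟩
  have hinj := (LinearMap.injective_iff_surjective_of_finrank_eq_finrank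
    (f := (proj v).comp E.1.subtype) (by rw [E.2]; simp)).2 hsurj
  intro y hy
  obtain ⟨w, hw, hwn, hwu⟩ := key (proj v y)
  have : w = y := congrArg Subtype.val (@hinj ⟨w, hw⟩ ⟨y, hy⟩ hwu)
  subst this
  linarith [norm_nonneg (proj v w)]

open Filter Topology in
/-- The slope of a planar tiling is unique. -/
theorem IsTiling.plane_eq (hT : IsTiling v T) (hL : IsLift T L) (hL' : IsLift T L')
    {E E' : Plane d n} {D D' : ℝ} (hE : NearPlane T L E.1 D) (hE' : NearPlane T L' E'.1 D') :
    E = E' := by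
  obtain ⟨c, hc, hbound⟩ := exists_slope_bound v
  have hb := hbound T hT L hL E D hE
  refine Subtype.ext (Submodule.eq_of_le_of_finrank_eq (fun y hy => ?_) (E.2.trans E'.2.symm))
  have h : ∀ N : ℕ, ∃ w ∈ E'.1, ‖w - (N : ℝ) • y‖ ≤
      D' + D + c * (diamBound v * D + 2 * diamBound v) := by
    intro N
    obtain ⟨τ, hτ, hxτ⟩ := hT.exists_mem ((N : ℝ) • proj v y)
    obtain ⟨σ, hσ, hxσ⟩ := hT.exists_mem 0
    obtain ⟨w, hw, hwz⟩ := hE' τ hτ σ hσ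
    obtain ⟨w', hw', hwz'⟩ := hE τ hτ σ hσ
    rw [← hL.sub_eq_sub hL' hT hτ hσ] at hwz
    set z := intVec (L τ.base - L σ.base) with hz
    have h4 := norm_base_sub_base_sub_le hxτ hxσ
    rw [hL.base_sub_base hT hτ hσ, sub_zero, ← hz] at h4
    have h5 : ‖proj v (z - w')‖ ≤ diamBound v * D :=
      (norm_proj_le _).trans (mul_le_mul_of_nonneg_left hwz' (diamBound_nonneg v))
    have h6 : ‖proj v (w' - (N : ℝ) • y)‖ ≤ diamBound v * D + 2 * diamBound v := by
      calc ‖proj v (w' - (N : ℝ) • y)‖ =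
            ‖(proj v z - (N : ℝ) • proj v y) - proj v (z - w')‖ := by
              rw [map_sub, map_sub, map_smul]; congr 1; abel
        _ ≤ _ := norm_sub_le _ _
        _ ≤ _ := by linarith
    have h7 := (hb _ (E.1.sub_mem hw' (E.1.smul_mem (N : ℝ) hy))).trans
      (mul_le_mul_of_nonneg_left h6 hc.le)
    refine ⟨w, hw, ?_⟩
    calc ‖w - (N : ℝ) • y‖ = ‖(z - w') - (z - w) + (w' - (N : ℝ) • y)‖ := by congr 1; abel
      _ ≤ ‖z - w'‖ + ‖z - w‖ + ‖w' - (N : ℝ) • y‖ :=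
        (norm_add_le _ _).trans (by gcongr; exact norm_sub_le _ _)
      _ ≤ _ := by linarith
  choose w hwE hw using h
  have h0 := tendsto_one_div_add_atTop_nhds_zero_nat (𝕜 := ℝ)
  have hlim : Tendsto (fun N : ℕ => (1 / ((N : ℝ) + 1)) • w (N + 1)) atTop (𝓝 y) := by
    refine tendsto_iff_norm_sub_tendsto_zero.2 (squeeze_zero (fun _ => norm_nonneg _)
      (g := fun N : ℕ => (1 / ((N : ℝ) + 1)) *
        (D' + D + c * (diamBound v * D + 2 * diamBound v))) (fun N => ?_)
      (by simpa using h0.mul_const (D' + D + c * (diamBound v * D + 2 * diamBound v))))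
    have hN : (0 : ℝ) < N + 1 := by positivity
    have := hw (N + 1)
    push_cast at this
    have he : (1 / ((N : ℝ) + 1)) • w (N + 1) - y =
        (1 / ((N : ℝ) + 1)) • (w (N + 1) - ((N : ℝ) + 1) • y) := by
      rw [smul_sub, smul_smul, one_div_mul_cancel hN.ne', one_smul]
    rw [he, norm_smul, Real.norm_of_nonneg (by positivity)]
    gcongr
  exact (Submodule.closed_of_finiteDimensional E'.1).mem_of_tendsto hlim
    (Eventually.of_forall fun N => E'.1.smul_mem _ (hwE _))

end Tilings

/-! ### Reduced matrices of planes -/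

section Planes

variable {n d : ℕ}

/-- The matrix `A` has an identity block in the columns selected by `ι`. -/
def IsReduced (ι : Fin d → Fin n) (A : Fin d → Fin n → ℝ) : Prop :=
  ∀ i i', A i (ι i') = if i = i' then 1 else 0

/-- The subspace spanned by the rows of a matrix. -/
def rowSpan (A : Fin d → Fin n → ℝ) : Submodule ℝ (EuclideanSpace ℝ (Fin n)) :=
  Submodule.span ℝ (range fun i => WithLp.toLp 2 (A i))

variable {ι : Fin d → Fin n} {A A' : Fin d → Fin n → ℝ}

theorem IsReduced.injective (h : IsReduced ι A) : Function.Injective ι := by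
  intro i i' hi
  by_contra hne
  have h1 := h i i
  have h2 := h i i'
  rw [hi, h2, if_neg hne] at h1
  simp at h1

theorem IsReduced.mem_rowSpan_iff (h : IsReduced ι A) {y : EuclideanSpace ℝ (Fin n)} :
    y ∈ rowSpan A ↔ ∀ j, y j = ∑ i, y (ι i) * A i j := by
  rw [rowSpan, Submodule.mem_span_range_iff_exists_fun]
  constructor
  · rintro ⟨c, rfl⟩ j
    have hc : ∀ j, (∑ i, c i • (WithLp.toLp 2 (A i) : EuclideanSpace ℝ (Fin n))) j =
        ∑ i, c i * A i j := fun j => by simp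
    simp only [hc]
    refine Finset.sum_congr rfl fun i _ => ?_
    congr 1
    simp [h _ i]
  · intro hy
    refine ⟨fun i => y (ι i), ?_⟩
    ext j
    simp [hy j]

/-- The combination of the rows of a matrix which has prescribed entries in the columns of `ι`. -/
def rowComb (ι : Fin d → Fin n) (A : Fin d → Fin n → ℝ) (x : EuclideanSpace ℝ (Fin n)) :
    EuclideanSpace ℝ (Fin n) := WithLp.toLp 2 fun j => ∑ i, x (ι i) * A i j

theorem IsReduced.rowComb_mem (h : IsReduced ι A) (x : EuclideanSpace ℝ (Fin n)) :
    rowComb ι A x ∈ rowSpan A := by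
  refine h.mem_rowSpan_iff.2 fun j => ?_
  have : ∀ i, (rowComb ι A x) (ι i) = x (ι i) := fun i => by simp [rowComb, h _ i]
  simp only [this]
  rfl

theorem IsReduced.finrank_rowSpan (h : IsReduced ι A) : Module.finrank ℝ (rowSpan A) = d := by
  have hli : LinearIndependent ℝ
      (fun i => (WithLp.toLp 2 (A i) : EuclideanSpace ℝ (Fin n))) := by
    refine Fintype.linearIndependent_iff.2 fun c hc i => ?_
    have := congrArg (fun x : EuclideanSpace ℝ (Fin n) => x (ι i)) hc
    simpa [h _ i] using this
  rw [rowSpan, finrank_span_eq_card hli, Fintype.card_fin]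

/-- The plane of a reduced matrix. -/
def IsReduced.plane (h : IsReduced ι A) : Plane d n := ⟨rowSpan A, h.finrank_rowSpan⟩

theorem IsReduced.plane_injective (h : IsReduced ι A) (h' : IsReduced ι A')
    (he : h.plane = h'.plane) : A = A' := by
  have he : rowSpan A = rowSpan A' := congrArg Subtype.val he
  ext i j
  have hi : (WithLp.toLp 2 (A i) : EuclideanSpace ℝ (Fin n)) ∈ rowSpan A' :=
    he ▸ Submodule.subset_span ⟨i, rfl⟩
  have := h'.mem_rowSpan_iff.1 hi j
  simpa [h i] using this

open Matrix in
theorem exists_det_submatrix_ne_zero {M : Matrix (Fin d) (Fin n) ℝ}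
    (hM : LinearIndependent ℝ M.row) : ∃ ι : Fin d → Fin n, (M.submatrix id ι).det ≠ 0 := by
  obtain ⟨κ, a, ha, hspan, hli⟩ := exists_linearIndependent' ℝ M.col
  have : Finite κ := Finite.of_injective a ha
  have : Fintype κ := Fintype.ofFinite κ
  have hcard : Fintype.card κ = d := by
    rw [← finrank_span_eq_card hli, hspan, ← Matrix.rank_eq_finrank_span_cols, hM.rank_matrix,
      Fintype.card_fin]
  let e : Fin d ≃ κ := (Fintype.equivFinOfCardEq hcard).symm
  refine ⟨a ∘ e, ?_⟩
  have h : LinearIndependent ℝ (M.submatrix id (a ∘ e)).col := hli.comp e e.injective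
  rw [Matrix.linearIndependent_cols_iff_isUnit, Matrix.isUnit_iff_isUnit_det] at h
  exact h.ne_zero

/-- Every plane has a reduced matrix with entries in `[-1, 1]`: use the columns of a minor of
maximal absolute value, and Cramer's rule. -/
theorem exists_isReduced (hn : 0 < n) (E : Plane d n) :
    ∃ (ι : Fin d → Fin n) (A : Fin d → Fin n → ℝ) (h : IsReduced ι A),
      (∀ i j, |A i j| ≤ 1) ∧ E = h.plane := by
  classical
  have : Nonempty (Fin d → Fin n) := ⟨fun _ => ⟨0, hn⟩⟩
  let b := Module.finBasisOfFinrankEq ℝ E.1 E.2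
  let M : Matrix (Fin d) (Fin n) ℝ := Matrix.of fun i j => (b i : EuclideanSpace ℝ (Fin n)) j
  have hM : LinearIndependent ℝ M.row := by
    have h1 := b.linearIndependent.map' E.1.subtype (Submodule.ker_subtype _)
    exact h1.map' (WithLp.linearEquiv 2 ℝ (Fin n → ℝ)).toLinearMap (LinearEquiv.ker _)
  obtain ⟨ι, hι⟩ := Finite.exists_max fun ι : Fin d → Fin n => |(M.submatrix id ι).det|
  obtain ⟨ι₀, hι₀⟩ := exists_det_submatrix_ne_zero hM
  have hdet : (M.submatrix id ι).det ≠ 0 :=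
    abs_pos.1 ((abs_pos.2 hι₀).trans_le (hι ι₀))
  let N := M.submatrix id ι
  let A : Matrix (Fin d) (Fin n) ℝ := N⁻¹ * M
  have hA : IsReduced ι A := by
    intro i i'
    have h1 : (N⁻¹ * N) i i' = if i = i' then 1 else 0 := by
      rw [Matrix.nonsing_inv_mul N (isUnit_iff_ne_zero.2 hdet), Matrix.one_apply]
    exact h1
  refine ⟨ι, A, hA, fun i j => ?_, ?_⟩
  · have h1 : A i j = (N.det)⁻¹ * (M.submatrix id (Function.update ι i j)).det := by
      have h2 : M.submatrix id (Function.update ι i j) = N.updateCol i (fun k => M k j) := by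
        ext k l
        by_cases hl : l = i
        · subst hl; simp
        · simp [hl, N]
      rw [h2, ← Matrix.cramer_apply, Matrix.cramer_eq_adjugate_mulVec]
      have h3 : A i j = N⁻¹.mulVec (fun k => M k j) i := rfl
      rw [h3, Matrix.inv_def, Ring.inverse_eq_inv', Matrix.smul_mulVec]
      rfl
    rw [h1, abs_mul, abs_inv]
    exact inv_mul_le_one_of_le₀ (hι _) (abs_nonneg _)
  · refine Subtype.ext (Submodule.eq_of_le_of_finrank_eq ?_ (hA.plane.2.trans E.2.symm)).symm
    refine Submodule.span_le.2 ?_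
    rintro _ ⟨i, rfl⟩
    have : (WithLp.toLp 2 (A i) : EuclideanSpace ℝ (Fin n)) =
        ∑ k, N⁻¹ i k • (b k : EuclideanSpace ℝ (Fin n)) := by
      ext j
      simp [A, Matrix.mul_apply, M]
    change (WithLp.toLp 2 (A i) : EuclideanSpace ℝ (Fin n)) ∈ E.1
    rw [this]
    exact E.1.sum_mem fun k _ => E.1.smul_mem _ (b k).2

/-! ### The metric on planes -/

theorem planeDist_comm (E F : Plane d n) : planeDist E F = planeDist F E := max_comm _ _

theorem planeDist_le {E F : Plane d n} {ε : ℝ} (hε : 0 ≤ ε)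
    (h : ∀ x ∈ E.1, ‖x‖ = 1 → ∃ y ∈ F.1, ‖x - y‖ ≤ ε)
    (h' : ∀ x ∈ F.1, ‖x‖ = 1 → ∃ y ∈ E.1, ‖x - y‖ ≤ ε) : planeDist E F ≤ ε := by
  have key : ∀ {E F : Plane d n}, (∀ x ∈ E.1, ‖x‖ = 1 → ∃ y ∈ F.1, ‖x - y‖ ≤ ε) →
      sSup ((fun x => Metric.infDist x (F.1 : Set (EuclideanSpace ℝ (Fin n)))) ''
        ((E.1 : Set (EuclideanSpace ℝ (Fin n))) ∩ Metric.sphere 0 1)) ≤ ε := by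
    intro E F h
    refine Real.sSup_le ?_ hε
    rintro _ ⟨x, ⟨hx, hx1⟩, rfl⟩
    obtain ⟨y, hy, hxy⟩ := h x hx (mem_sphere_zero_iff_norm.1 hx1)
    exact (Metric.infDist_le_dist_of_mem hy).trans (by rwa [dist_eq_norm])
  exact max_le (key h) (key h')

theorem exists_mem_of_planeDist_lt {E F : Plane d n} {r : ℝ} (h : planeDist E F < r)
    {x : EuclideanSpace ℝ (Fin n)} (hx : x ∈ E.1) : ∃ y ∈ F.1, ‖x - y‖ ≤ r * ‖x‖ := by
  by_cases h0 : x = 0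
  · exact ⟨0, F.1.zero_mem, by simp [h0]⟩
  have hpos : 0 < ‖x‖ := norm_pos_iff.2 h0
  have hbdd : BddAbove ((fun x => Metric.infDist x (F.1 : Set (EuclideanSpace ℝ (Fin n)))) ''
        ((E.1 : Set (EuclideanSpace ℝ (Fin n))) ∩ Metric.sphere 0 1)) := by
    refine ⟨1, ?_⟩
    rintro _ ⟨z, ⟨-, hz⟩, rfl⟩
    refine (Metric.infDist_le_dist_of_mem F.1.zero_mem).trans ?_
    rw [dist_zero_right, mem_sphere_zero_iff_norm.1 hz]
  have hmem : ‖x‖⁻¹ • x ∈ (E.1 : Set (EuclideanSpace ℝ (Fin n))) ∩ Metric.sphere 0 1 := by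
    refine ⟨E.1.smul_mem _ hx, ?_⟩
    rw [mem_sphere_zero_iff_norm, norm_smul, norm_inv, norm_norm, inv_mul_cancel₀ hpos.ne']
  have hlt := ((le_csSup hbdd (mem_image_of_mem _ hmem)).trans (le_max_left _ _)).trans_lt h
  obtain ⟨y, hy, hxy⟩ := (Metric.infDist_lt_iff ⟨0, F.1.zero_mem⟩).1 hlt
  refine ⟨‖x‖ • y, F.1.smul_mem _ hy, ?_⟩
  have : x - ‖x‖ • y = ‖x‖ • (‖x‖⁻¹ • x - y) := by
    rw [smul_sub, smul_smul, mul_inv_cancel₀ hpos.ne', one_smul]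
  rw [this, norm_smul, norm_norm, mul_comm]
  rw [dist_eq_norm] at hxy
  exact mul_le_mul_of_nonneg_right hxy.le (norm_nonneg x)

theorem IsReduced.planeDist_le (h : IsReduced ι A) (h' : IsReduced ι A') {η : ℝ}
    (hη : ∀ i j, |A i j - A' i j| ≤ η) (hη0 : 0 ≤ η) :
    planeDist h.plane h'.plane ≤ n * (d * η) := by
  have key : ∀ {A A' : Fin d → Fin n → ℝ}, IsReduced ι A → IsReduced ι A' →
      (∀ i j, |A i j - A' i j| ≤ η) →
      ∀ x ∈ rowSpan A, ‖x‖ = 1 → ∃ y ∈ rowSpan A', ‖x - y‖ ≤ n * (d * η) := by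
    intro A A' h h' hη x hx hx1
    refine ⟨rowComb ι A' x, h'.rowComb_mem x, norm_le_of_abs_le (by positivity) fun j => ?_⟩
    have h1 : (x - rowComb ι A' x) j = ∑ i, x (ι i) * (A i j - A' i j) := by
      simp only [mul_sub, Finset.sum_sub_distrib]
      rw [← h.mem_rowSpan_iff.1 hx j]
      rfl
    rw [h1]
    calc |∑ i, x (ι i) * (A i j - A' i j)| ≤ ∑ i, |x (ι i) * (A i j - A' i j)| :=
          Finset.abs_sum_le_sum_abs _ _
      _ ≤ ∑ _i : Fin d, η := Finset.sum_le_sum fun i _ => by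
          rw [abs_mul]
          have := hx1 ▸ abs_apply_le_norm x (ι i)
          exact (mul_le_of_le_one_left (abs_nonneg _) this).trans (hη i j)
      _ = d * η := by simp
  exact PlanarTilings.planeDist_le (by positivity) (key h h' hη)
    (key h' h fun i j => by rw [abs_sub_comm]; exact hη i j)

/-- A vector close to the plane of a reduced matrix nearly satisfies its equations. -/
theorem IsReduced.abs_sub_le (h : IsReduced ι A) (hA : ∀ i j, |A i j| ≤ 1)
    {x y : EuclideanSpace ℝ (Fin n)} (hy : y ∈ rowSpan A) {D : ℝ} (hxy : ‖x - y‖ ≤ D) (j : Fin n) :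
    |x j - ∑ i, x (ι i) * A i j| ≤ (d + 1) * D := by
  have hc : ∀ j, |x j - y j| ≤ D := fun j => (abs_apply_le_norm (x - y) j).trans hxy
  have h1 : x j - ∑ i, x (ι i) * A i j = (x j - y j) - ∑ i, (x (ι i) - y (ι i)) * A i j := by
    simp only [sub_mul, Finset.sum_sub_distrib]
    rw [← h.mem_rowSpan_iff.1 hy j]
    ring
  have h2 : |∑ i, (x (ι i) - y (ι i)) * A i j| ≤ d * D := by
    calc |∑ i, (x (ι i) - y (ι i)) * A i j| ≤ ∑ i, |(x (ι i) - y (ι i)) * A i j| :=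
          Finset.abs_sum_le_sum_abs _ _
      _ ≤ ∑ _i : Fin d, D := Finset.sum_le_sum fun i _ => by
          rw [abs_mul]
          exact (mul_le_of_le_one_right (abs_nonneg _) (hA i j)).trans (hc _)
      _ = d * D := by simp
  rw [h1]
  calc _ ≤ |x j - y j| + |∑ i, (x (ι i) - y (ι i)) * A i j| := abs_sub _ _
    _ ≤ (d + 1) * D := by linarith [hc j]

theorem IsReduced.exists_mem_rowSpan (h : IsReduced ι A) {x : EuclideanSpace ℝ (Fin n)} {D : ℝ}
    (hD : 0 ≤ D) (hx : ∀ j, |x j - ∑ i, x (ι i) * A i j| ≤ D) :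
    ∃ y ∈ rowSpan A, ‖x - y‖ ≤ n * D :=
  ⟨rowComb ι A x, h.rowComb_mem x, norm_le_of_abs_le hD hx⟩

/-! ### Grids of rational planes -/

/-- The code of the matrix with an identity block in the columns of `ι`, and the other entries
`α i j / (m + 1) - 1`. -/
def gridCode (ι : Fin d → Fin n) (m : ℕ) (α : Fin d → Fin n → ℕ) : Fin d → Fin n → ℕ × ℕ × ℕ :=
  open Classical in
  fun i j => if j ∈ range ι then (if ι i = j then (1, 0, 0) else (0, 0, 0)) else (α i j, m + 1, m)

/-- The real matrix of code `gridCode`. -/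
def gridMatrix (ι : Fin d → Fin n) (m : ℕ) (α : Fin d → Fin n → ℕ) (i : Fin d) (j : Fin n) : ℝ :=
  ((ratOfCode (gridCode ι m α i j) : ℚ) : ℝ)

theorem gridMatrix_of_notMem {m : ℕ} {α : Fin d → Fin n → ℕ} {j : Fin n} (hj : j ∉ range ι)
    (i : Fin d) : gridMatrix ι m α i j = α i j / (m + 1) - 1 := by
  have hm : (m : ℝ) + 1 ≠ 0 := by positivity
  simp only [gridMatrix, gridCode, if_neg hj, ratOfCode]
  push_cast
  field_simp

theorem isReduced_gridMatrix (hι : Function.Injective ι) (m : ℕ) (α : Fin d → Fin n → ℕ) :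
    IsReduced ι (gridMatrix ι m α) := by
  intro i i'
  simp only [gridMatrix, gridCode, mem_range_self, if_true, hι.eq_iff]
  split_ifs <;> simp [ratOfCode]

theorem isPlaneCode_gridCode (hι : Function.Injective ι) (m : ℕ) (α : Fin d → Fin n → ℕ) :
    IsPlaneCode (gridCode ι m α) (isReduced_gridMatrix hι m α).plane := rfl

theorem abs_gridMatrix_le (hι : Function.Injective ι) {m : ℕ} {α : Fin d → Fin n → ℕ}
    (hα : ∀ i j, α i j ≤ 2 * (m + 1)) (i : Fin d) (j : Fin n) : |gridMatrix ι m α i j| ≤ 1 := by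
  by_cases hj : j ∈ range ι
  · obtain ⟨i', rfl⟩ := hj
    rw [isReduced_gridMatrix hι m α]
    split_ifs <;> simp
  · rw [gridMatrix_of_notMem hj]
    have hm : (0 : ℝ) < m + 1 := by positivity
    have h1 : (α i j : ℝ) ≤ 2 * (m + 1) := by exact_mod_cast hα i j
    have h2 : (α i j : ℝ) / (m + 1) ≤ 2 := by rwa [div_le_iff₀ hm]
    have h3 : 0 ≤ (α i j : ℝ) / (m + 1) := by positivity
    exact abs_le.2 ⟨by linarith, by linarith⟩

theorem IsReduced.exists_grid (h : IsReduced ι A) (hA : ∀ i j, |A i j| ≤ 1) (m : ℕ) :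
    ∃ α : Fin d → Fin n → ℕ, (∀ i j, α i j ≤ 2 * (m + 1)) ∧
      ∀ i j, |A i j - gridMatrix ι m α i j| ≤ 1 / (m + 1) := by
  have hm : (0 : ℝ) < m + 1 := by positivity
  have h0 : ∀ i j, 0 ≤ (A i j + 1) * (m + 1) := fun i j =>
    mul_nonneg (by linarith [(abs_le.1 (hA i j)).1]) hm.le
  refine ⟨fun i j => ⌊(A i j + 1) * (m + 1)⌋₊, fun i j => ?_, fun i j => ?_⟩
  · have : (⌊(A i j + 1) * (m + 1)⌋₊ : ℝ) ≤ 2 * (m + 1) :=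
      (Nat.floor_le (h0 i j)).trans
        (mul_le_mul_of_nonneg_right (by linarith [(abs_le.1 (hA i j)).2]) hm.le)
    exact_mod_cast this
  · by_cases hj : j ∈ range ι
    · obtain ⟨i', rfl⟩ := hj
      rw [isReduced_gridMatrix h.injective m, h]
      simp only [sub_self, abs_zero]
      positivity
    · rw [gridMatrix_of_notMem hj]
      have h1 := Nat.floor_le (h0 i j)
      have h2 := Nat.lt_floor_add_one ((A i j + 1) * (m + 1))
      have h3 : A i j - (⌊(A i j + 1) * (m + 1)⌋₊ / (m + 1) - 1) =
          ((A i j + 1) * (m + 1) - ⌊(A i j + 1) * (m + 1)⌋₊) / (m + 1) := by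
        field_simp
        ring
      rw [h3, abs_of_nonneg (div_nonneg (by linarith) hm.le)]
      exact div_le_div_of_nonneg_right (by linarith) hm.le

end Planes

/-! ### Symbolic configurations -/

section Configurations

variable {n d k : ℕ} {v : Fin n → Fin d → ℝ}

/-- A configuration: at each point `z` of `ℤ^n`, and for each set `I` of directions, it tells
whether a lifted tile with base `z` and directions `I` is present, and its color. -/
abbrev Config (n k : ℕ) : Type := (Fin n → ℤ) → Finset (Fin n) → Option (Fin k)

/-- `X` is the configuration of the lift `L` of the tiling `T` colored by `c`. -/
def IsConfigOf (X : Config n k) (T : Set (Tile v)) (c : T → Fin k)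
    (L : (Fin d → ℝ) → Fin n → ℤ) : Prop :=
  ∀ z I a, X z I = some a ↔ ∃ τ, ∃ h : τ ∈ T, L τ.base = z ∧ τ.dirs = I ∧ c ⟨τ, h⟩ = a

theorem exists_isConfigOf {T : Set (Tile v)} (c : T → Fin k) {L : (Fin d → ℝ) → Fin n → ℤ}
    (hT : IsTiling v T) (hL : IsLift T L) : ∃ X : Config n k, IsConfigOf X T c L := by
  classical
  refine ⟨fun z I => if h : ∃ τ : T, L τ.1.base = z ∧ τ.1.dirs = I then some (c h.choose) else none,
    fun z I a => ?_⟩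
  dsimp only
  constructor
  · intro h
    split_ifs at h with hex
    exact ⟨hex.choose.1, hex.choose.2, hex.choose_spec.1, hex.choose_spec.2, Option.some.inj h⟩
  · rintro ⟨τ, hτ, hz, hI, ha⟩
    have hex : ∃ τ : T, L τ.1.base = z ∧ τ.1.dirs = I := ⟨⟨τ, hτ⟩, hz, hI⟩
    have heq : hex.choose = ⟨τ, hτ⟩ := by
      obtain ⟨h1, h2⟩ := hex.choose_spec
      have h3 := hL.base_sub_base hT hex.choose.2 hτ
      rw [h1, hz, sub_self] at h3
      have h4 : proj v (intVec 0) = 0 := by simp [proj_apply]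
      rw [h4, sub_eq_zero] at h3
      exact Subtype.ext (Tile.ext h3 (h2.trans hI.symm))
    rw [dif_pos hex, heq, ha]

/-- `X` is the configuration of a lift of a colored tiling in which no patch of `F` occurs. -/
def ValidConfig (F : Finset (Finset (Tile v × Fin k))) (X : Config n k) : Prop :=
  ∃ (T : Set (Tile v)) (c : T → Fin k) (L : (Fin d → ℝ) → Fin n → ℤ), IsTiling v T ∧
    (∀ P ∈ F, ¬ ColoredOccurs P T c) ∧ IsLift T L ∧ IsConfigOf X T c L

/-- The window of radius `C` of `Y` around `z` also appears in some valid configuration. -/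
def LocallyValid (F : Finset (Finset (Tile v × Fin k))) (C : ℕ) (Y : Config n k)
    (z : Fin n → ℤ) : Prop :=
  ∃ X, ValidConfig F X ∧ ∃ w, ∀ δ : Fin n → ℤ, (∀ i, |δ i| ≤ C) → Y (z + δ) = X (w + δ)

/-- A lifted tile with base `z` is present in `Y`. -/
def Present (Y : Config n k) (z : Fin n → ℤ) : Prop := ∃ I a, Y z I = some a

/-- A configuration that is valid up to scale `C`, and in which tiles with close projections have
close lifts. -/
structure GoodConfig (F : Finset (Finset (Tile v × Fin k))) (C : ℕ) (R₀ : ℝ)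
    (Y : Config n k) : Prop where
  locallyValid : ∀ z, LocallyValid F C Y z
  proper : ∀ z z', Present Y z → Present Y z' → ‖proj v (intVec (z - z'))‖ ≤ R₀ →
    ∀ j, |z j - z' j| ≤ C

/-- The tiles obtained by projecting a configuration. -/
def projTiles (v : Fin n → Fin d → ℝ) (Y : Config n k) : Set (Tile v) :=
  {τ | ∃ a z, Y z τ.dirs = some a ∧ τ.base = proj v (intVec z)}

variable {F : Finset (Finset (Tile v × Fin k))} {C : ℕ} {R₀ : ℝ} {Y : Config n k}

/-- Around each of its tiles, the projection of a good configuration coincides, up to a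
translation, with a tiling in which no patch of `F` occurs. -/
theorem GoodConfig.exists_local (hY : GoodConfig F C R₀ Y) {τ : Tile v}
    (hτ : τ ∈ projTiles v Y) :
    ∃ (T : Set (Tile v)) (c : T → Fin k) (L : (Fin d → ℝ) → Fin n → ℤ) (u : Fin d → ℝ)
      (w : Fin n → ℤ), IsTiling v T ∧ (∀ P ∈ F, ¬ ColoredOccurs P T c) ∧ IsLift T L ∧
      (∀ (τ' : Tile v) (z' : Fin n → ℤ) (a' : Fin k), Y z' τ'.dirs = some a' →
        τ'.base = proj v (intVec z') → ‖τ'.base - τ.base‖ ≤ R₀ →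
        (∃ h : τ'.translate u ∈ T, c ⟨_, h⟩ = a') ∧ L (τ'.translate u).base = z' + w) ∧
      (∀ σ ∈ T, (∀ j, |L σ.base j - L (τ.translate u).base j| ≤ C) →
        σ.translate (-u) ∈ projTiles v Y) := by
  obtain ⟨a, z, hz, hτz⟩ := hτ
  obtain ⟨X, ⟨T, c, L, hT, hF, hL, hX⟩, w, hw⟩ := hY.locallyValid z
  have hwin : ∀ z' : Fin n → ℤ, (∀ j, |z' j - z j| ≤ C) → Y z' = X (z' + (w - z)) := by
    intro z' hz'
    have := hw (z' - z) (fun i => by simpa using hz' i)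
    rw [add_sub_cancel] at this
    rw [this]
    congr 1
    abel
  obtain ⟨σ₀, hσ₀, hL₀, hd₀, -⟩ := (hX _ _ _).1 ((hwin z (by simp)) ▸ hz)
  have hpos : ∀ σ ∈ T, ∀ z', L σ.base = z' + (w - z) →
      σ.base = proj v (intVec z') + (σ₀.base - τ.base) := by
    intro σ hσ z' hz'
    have h1 := hL.base_sub_base hT hσ hσ₀
    rw [hz', hL₀, add_sub_add_right_eq_sub, intVec_sub, map_sub, ← hτz] at h1
    rw [sub_eq_iff_eq_add] at h1
    rw [h1]
    abel
  have hτσ : τ.translate (σ₀.base - τ.base) = σ₀ := by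
    ext1
    · simp [Tile.translate]
    · exact hd₀.symm
  refine ⟨T, c, L, σ₀.base - τ.base, w - z, hT, hF, hL, ?_, ?_⟩
  · intro τ' z' a' hY' hb' hR
    have hclose : ∀ j, |z' j - z j| ≤ C := by
      refine hY.proper z' z ⟨_, _, hY'⟩ ⟨_, _, hz⟩ ?_
      rwa [intVec_sub, map_sub, ← hb', ← hτz]
    obtain ⟨σ, hσ, hLσ, hdσ, hcσ⟩ := (hX _ _ _).1 ((hwin z' hclose) ▸ hY')
    have hσ' : τ'.translate (σ₀.base - τ.base) = σ := by
      ext1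
      · rw [hpos σ hσ z' hLσ, ← hb']
        rfl
      · exact hdσ.symm
    rw [hσ']
    exact ⟨⟨hσ, hcσ⟩, hLσ⟩
  · intro σ hσ hclose
    have hz' : L σ.base = (L σ.base - (w - z)) + (w - z) := by abel
    rw [hτσ, hL₀] at hclose
    refine ⟨c ⟨σ, hσ⟩, L σ.base - (w - z), ?_, ?_⟩
    · rw [hwin _ fun j => ?_]
      · exact (hX _ _ _).2 ⟨σ, hσ, hz', rfl, rfl⟩
      · have := hclose j
        simp only [Pi.sub_apply, Pi.add_apply] at this ⊢
        convert this using 2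
        ring
    · change σ.base + -_ = _
      rw [← sub_eq_add_neg]
      exact sub_eq_iff_eq_add.2 (hpos σ hσ _ hz')

theorem preimage_support_translate (τ : Tile v) (u : Fin d → ℝ) :
    (fun x => x + u) ⁻¹' (τ.translate u).support = τ.support := by
  ext x
  exact Tile.mem_support_translate

theorem preimage_mem_properFaces {τ : Tile v} {u : Fin d → ℝ} {f : Set (Fin d → ℝ)}
    (hf : f ∈ (τ.translate u).properFaces) : (fun x => x + u) ⁻¹' f ∈ τ.properFaces := by
  obtain ⟨A, B, hA, hB, hd, rfl⟩ := hf
  refine ⟨A, B, hA, hB, hd, ?_⟩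
  ext x
  rw [mem_preimage, Tile.vertex_translate, parallelotope_add]

theorem norm_base_sub_base_le {τ σ : Tile v} (h : (τ.support ∩ σ.support).Nonempty) :
    ‖τ.base - σ.base‖ ≤ 2 * diamBound v := by
  obtain ⟨x, hx, hx'⟩ := h
  simpa using norm_base_sub_base_sub_le hx hx'

theorem GoodConfig.exists_tile (hY : GoodConfig F C R₀ Y) {z : Fin n → ℤ} {I : Finset (Fin n)}
    {a : Fin k} (hz : Y z I = some a) :
    ∃ τ : Tile v, τ.dirs = I ∧ τ.base = proj v (intVec z) := by
  obtain ⟨X, ⟨T, c, L, hT, hF, hL, hX⟩, w, hw⟩ := hY.locallyValid z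
  have := hw 0 (by simp)
  simp only [add_zero] at this
  obtain ⟨σ, -, -, hd, -⟩ := (hX _ _ _).1 (this ▸ hz)
  subst hd
  exact ⟨⟨proj v (intVec z), σ.dirs, σ.card_dirs, σ.linearIndependent⟩, rfl, rfl⟩

/-- The projection of a good configuration is a tiling. It covers the space because the set that it
covers contains the unit ball around each of its points. -/
theorem GoodConfig.isTiling (hY : GoodConfig F C R₀ Y) (hR : 2 * diamBound v ≤ R₀)
    (hC : ∀ T : Set (Tile v), IsTiling v T → ∀ L, IsLift T L → ∀ τ ∈ T, ∀ σ ∈ T,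
      ∀ x ∈ τ.support, ∀ y ∈ σ.support, ‖x - y‖ ≤ 1 → ∀ j, |L τ.base j - L σ.base j| ≤ C)
    (h0 : Present Y 0) : IsTiling v (projTiles v Y) := by
  have hmem : ∀ τ ∈ projTiles v Y, ∃ a z, Y z τ.dirs = some a ∧ τ.base = proj v (intVec z) :=
    fun τ hτ => hτ
  have hRpos : (0 : ℝ) ≤ R₀ := (mul_nonneg zero_le_two (diamBound_nonneg v)).trans hR
  constructor
  · set U := ⋃ τ ∈ projTiles v Y, τ.support with hU
    have hball : ∀ x ∈ U, ∀ y, ‖y - x‖ ≤ 1 → y ∈ U := by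
      intro x hx y hxy
      simp only [hU, mem_iUnion, exists_prop] at hx ⊢
      obtain ⟨τ, hτ, hxτ⟩ := hx
      obtain ⟨T, c, L, u, w, hT, -, hL, hin, hout⟩ := hY.exists_local hτ
      obtain ⟨a, z, ha, hz⟩ := hmem τ hτ
      obtain ⟨⟨hτT, -⟩, -⟩ := hin τ z a ha hz (by simpa using hRpos)
      obtain ⟨σ, hσ, hyσ⟩ := hT.exists_mem (y + u)
      refine ⟨_, hout σ hσ fun j => hC T hT L hL σ hσ _ hτT _ hyσ _
        (Tile.mem_support_translate.2 hxτ) (by simpa using hxy) j, ?_⟩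
      have := (Tile.mem_support_translate (u := -u)).2 hyσ
      simpa using this
    have hclopen : IsClopen U := by
      constructor
      · rw [← isOpen_compl_iff, Metric.isOpen_iff]
        refine fun y hy => ⟨1, one_pos, fun x hx hxU => hy (hball x hxU y ?_)⟩
        rw [norm_sub_rev]
        exact (mem_ball_iff_norm.1 hx).le
      · rw [Metric.isOpen_iff]
        exact fun x hx => ⟨1, one_pos, fun y hy => hball x hx y (mem_ball_iff_norm.1 hy).le⟩
    refine hclopen.eq_univ ?_
    obtain ⟨I, a, ha⟩ := h0
    obtain ⟨τ, hτ, hb⟩ := hY.exists_tile ha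
    exact ⟨τ.base, mem_biUnion (show τ ∈ projTiles v Y from ⟨a, 0, hτ ▸ ha, hb⟩)
      τ.base_mem_support⟩
  · intro τ hτ σ hσ hne
    rcases eq_empty_or_nonempty (τ.support ∩ σ.support) with h | h
    · exact Or.inl h
    right
    obtain ⟨T, c, L, u, w, hT, -, hL, hin, -⟩ := hY.exists_local hτ
    obtain ⟨a, z, ha, hz⟩ := hmem τ hτ
    obtain ⟨a', z', ha', hz'⟩ := hmem σ hσ
    obtain ⟨⟨hτT, -⟩, -⟩ := hin τ z a ha hz (by simpa using hRpos)
    obtain ⟨⟨hσT, -⟩, -⟩ := hin σ z' a' ha' hz'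
      ((norm_base_sub_base_le (by rwa [inter_comm])).trans hR)
    have hpre : (fun x => x + u) ⁻¹' ((τ.translate u).support ∩ (σ.translate u).support) =
        τ.support ∩ σ.support := by
      rw [preimage_inter, preimage_support_translate, preimage_support_translate]
    rcases hT.faceToFace _ hτT _ hσT fun he => hne (Tile.translate_injective u he) with h' | h'
    · rw [h', preimage_empty] at hpre
      exact absurd hpre.symm h.ne_empty
    · rw [← hpre]
      exact ⟨preimage_mem_properFaces h'.1, preimage_mem_properFaces h'.2⟩

/-- The vertices of the projection of a good configuration have a well-defined lift. -/
theorem GoodConfig.lift_eq (hY : GoodConfig F C R₀ Y) (hR : 2 * diamBound v ≤ R₀) {τ σ : Tile v}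
    {z z' : Fin n → ℤ} {a a' : Fin k} {S S' : Finset (Fin n)}
    (hz : Y z τ.dirs = some a) (hτ : τ.base = proj v (intVec z))
    (hz' : Y z' σ.dirs = some a') (hσ : σ.base = proj v (intVec z'))
    (hS : S ⊆ τ.dirs) (hS' : S' ⊆ σ.dirs) (h : τ.vertex S = σ.vertex S') :
    z + indVec S = z' + indVec S' := by
  have hRpos : (0 : ℝ) ≤ R₀ := (mul_nonneg zero_le_two (diamBound_nonneg v)).trans hR
  obtain ⟨T, c, L, u, w, hT, -, hL, hin, -⟩ :=
    hY.exists_local (τ := τ) ⟨a, z, hz, hτ⟩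
  obtain ⟨⟨hτT, -⟩, h1⟩ := hin τ z a hz hτ (by simpa using hRpos)
  obtain ⟨⟨hσT, -⟩, h2⟩ := hin σ z' a' hz' hσ
    ((norm_base_sub_base_le ⟨_, σ.vertex_mem_support hS', h ▸ τ.vertex_mem_support hS⟩).trans hR)
  have h3 := hL.apply_vertex hτT (S := S) hS
  have h4 := hL.apply_vertex hσT (S := S') hS'
  rw [Tile.vertex_translate] at h3 h4
  rw [← h, h3, h1, h2, add_right_comm, add_right_comm z'] at h4
  exact add_right_cancel h4

/-- The projection of a good configuration that stays near a plane is a tiling in which no patch of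
`F` occurs, and it has a lift near this plane. -/
theorem GoodConfig.exists_tiling (hY : GoodConfig F C R₀ Y) (hR : 2 * diamBound v ≤ R₀)
    (hC : ∀ T : Set (Tile v), IsTiling v T → ∀ L, IsLift T L → ∀ τ ∈ T, ∀ σ ∈ T,
      ∀ x ∈ τ.support, ∀ y ∈ σ.support, ‖x - y‖ ≤ 1 → ∀ j, |L τ.base j - L σ.base j| ≤ C)
    (hF : ∀ P ∈ F, ∀ a ∈ P, ∀ b ∈ P, ‖a.1.base - b.1.base‖ ≤ R₀)
    (h0 : Present Y 0) {E : Submodule ℝ (EuclideanSpace ℝ (Fin n))} {D : ℝ}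
    (hE : ∀ z, Present Y z → ∃ y ∈ E, ‖intVec z - y‖ ≤ D) :
    ∃ T ∈ coloredTilingSpace F, ∃ L, IsLift T L ∧ NearPlane T L E (2 * D) := by
  classical
  have hT := hY.isTiling hR hC h0
  choose c z hz hb using fun τ : projTiles v Y => τ.2
  have hRpos : (0 : ℝ) ≤ R₀ := (mul_nonneg zero_le_two (diamBound_nonneg v)).trans hR
  let L : (Fin d → ℝ) → Fin n → ℤ := fun p =>
    if h : ∃ x : projTiles v Y × Finset (Fin n), x.2 ⊆ x.1.1.dirs ∧ p = x.1.1.vertex x.2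
    then z h.choose.1 + indVec h.choose.2 else 0
  have hLv : ∀ (τ : projTiles v Y) (S : Finset (Fin n)), S ⊆ τ.1.dirs →
      L (τ.1.vertex S) = z τ + indVec S := by
    intro τ S hS
    have h : ∃ x : projTiles v Y × Finset (Fin n),
        x.2 ⊆ x.1.1.dirs ∧ τ.1.vertex S = x.1.1.vertex x.2 := ⟨(τ, S), hS, rfl⟩
    simp only [L, dif_pos h]
    exact (hY.lift_eq hR (hz τ) (hb τ) (hz _) (hb _) hS h.choose_spec.1 h.choose_spec.2).symm
  have hLb : ∀ τ : projTiles v Y, L τ.1.base = z τ := by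
    intro τ
    have := hLv τ ∅ (Finset.empty_subset _)
    rw [Tile.vertex_empty] at this
    rw [this]
    ext i
    simp [indVec]
  refine ⟨projTiles v Y, ⟨hT, c, fun P hP ⟨u₀, hu₀⟩ => ?_⟩, L, ⟨?_, ?_⟩, ?_⟩
  · rcases P.eq_empty_or_nonempty with rfl | ⟨b, hbP⟩
    · obtain ⟨τ, hτ, -⟩ := hT.exists_mem 0
      obtain ⟨T, c', L', u, w, -, hav, -⟩ := hY.exists_local hτ
      exact hav _ hP ⟨0, by simp⟩
    · obtain ⟨hbT, -⟩ := hu₀ b hbP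
      obtain ⟨T, c', L', u, w, -, hav, -, hin, -⟩ := hY.exists_local hbT
      refine hav P hP ⟨u₀ + u, fun a ha => ?_⟩
      obtain ⟨haT, hac⟩ := hu₀ a ha
      have h1 := hz ⟨_, haT⟩
      rw [hac] at h1
      have h2 := (hin _ _ _ h1 (hb ⟨_, haT⟩)
        (by simpa [Tile.translate] using hF P hP a ha b hbP)).1
      rwa [Tile.translate_translate] at h2
  · obtain ⟨I, a, ha⟩ := h0
    obtain ⟨τ, hτ, hbτ⟩ := hY.exists_tile ha
    have hτT : τ ∈ projTiles v Y := ⟨a, 0, hτ ▸ ha, hbτ⟩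
    refine ⟨τ.base, ⟨τ, hτT, ∅, Finset.empty_subset _, τ.vertex_empty.symm⟩, ?_⟩
    have := hY.lift_eq hR (hz ⟨τ, hτT⟩) (hb ⟨τ, hτT⟩) (hτ ▸ ha) hbτ (Finset.empty_subset _)
      (Finset.empty_subset _) rfl
    rw [hLb ⟨τ, hτT⟩]
    exact add_right_cancel this
  · intro τ hτ S hS i hi hiS
    have h1 : τ.vertex S + v i = τ.vertex (insert i S) := by
      simp only [Tile.vertex, Finset.sum_insert hiS]
      abel
    rw [h1, hLv ⟨τ, hτ⟩ S hS, hLv ⟨τ, hτ⟩ _ (Finset.insert_subset hi hS), add_assoc]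
    congr 1
    ext j
    by_cases hj : j = i
    · subst hj
      simp [indVec, hiS]
    · simp [indVec, hj]
  · intro τ hτ σ hσ
    obtain ⟨y, hy, hyz⟩ := hE _ ⟨_, _, hz ⟨τ, hτ⟩⟩
    obtain ⟨y', hy', hyz'⟩ := hE _ ⟨_, _, hz ⟨σ, hσ⟩⟩
    refine ⟨y - y', E.sub_mem hy hy', ?_⟩
    rw [hLb ⟨τ, hτ⟩, hLb ⟨σ, hσ⟩, intVec_sub, sub_sub_sub_comm]
    exact (norm_sub_le _ _).trans (by linarith)

/-! ### Configurations on boxes -/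

/-- On the box of radius `R`, the configuration `Y` is locally valid, has a tile with base `0`, and
its tiles nearly satisfy the equations of the plane of the reduced matrix `A`. -/
structure BoxConfig (F : Finset (Finset (Tile v × Fin k))) (C : ℕ) (D : ℝ) (ι : Fin d → Fin n)
    (A : Fin d → Fin n → ℝ) (R : ℕ) (Y : Config n k) : Prop where
  locallyValid : ∀ z : Fin n → ℤ, (∀ i, |z i| + C ≤ R) → LocallyValid F C Y z
  present : Present Y 0
  near : ∀ z : Fin n → ℤ, (∀ i, |z i| ≤ R) → Present Y z →
    ∀ j, |(z j : ℝ) - ∑ i, (z (ι i) : ℝ) * A i j| ≤ D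

open Filter Topology in
/-- Compactness: configurations on larger and larger boxes have a limit. -/
theorem exists_limit_config {D : ℝ} {ι : Fin d → Fin n} {A : ℕ → Fin d → Fin n → ℝ}
    {A' : Fin d → Fin n → ℝ} {Y : ℕ → Config n k} {r : ℕ → ℕ} (l : Ultrafilter ℕ)
    (hr : Tendsto r l atTop) (hY : ∀ᶠ s in l, BoxConfig F C D ι (A s) (r s) (Y s))
    (hA : ∀ i j, Tendsto (fun s => A s i j) l (𝓝 (A' i j))) :
    ∃ Y', ∀ R, BoxConfig F C D ι A' R Y' := by
  have hlim : ∀ z, ∃ s, ∀ᶠ R in l, Y R z = s := by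
    intro z
    obtain ⟨s, hs⟩ := (l.map fun R => Y R z).eq_pure_of_finite
    refine ⟨s, ?_⟩
    have h1 : {s} ∈ l.map fun R => Y R z := by rw [hs]; exact mem_singleton s
    exact h1
  choose Y' hY' using hlim
  refine ⟨Y', fun R => ⟨fun z hz => ?_, ?_, fun z hz hpres j => ?_⟩⟩
  · have hfin : {δ : Fin n → ℤ | ∀ i, |δ i| ≤ C}.Finite := by
      refine (finite_Icc (fun _ : Fin n => -(C : ℤ)) fun _ => (C : ℤ)).subset fun δ hδ => ?_
      exact ⟨fun i => (abs_le.1 (hδ i)).1, fun i => (abs_le.1 (hδ i)).2⟩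
    have hev : ∀ᶠ s in l, ∀ δ ∈ {δ : Fin n → ℤ | ∀ i, |δ i| ≤ C}, Y s (z + δ) = Y' (z + δ) :=
      (eventually_all_finite hfin).2 fun δ _ => hY' _
    obtain ⟨s, hs, hYs, hRs⟩ := (hev.and (hY.and (hr.eventually_ge_atTop R))).exists
    obtain ⟨X, hX, w, hw⟩ := hYs.locallyValid z fun i =>
      (hz i).trans (by exact_mod_cast hRs)
    exact ⟨X, hX, w, fun δ hδ => (hs δ hδ).symm.trans (hw δ hδ)⟩
  · obtain ⟨s, hs, hYs⟩ := ((hY' 0).and hY).exists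
    obtain ⟨I, a, h⟩ := hYs.present
    exact ⟨I, a, hs ▸ h⟩
  · have hcont : Tendsto (fun s => |(z j : ℝ) - ∑ i, (z (ι i) : ℝ) * A s i j|) l
        (𝓝 |(z j : ℝ) - ∑ i, (z (ι i) : ℝ) * A' i j|) :=
      (tendsto_const_nhds.sub (tendsto_finsetSum _ fun i _ => (hA i j).const_mul _)).abs
    refine le_of_tendsto hcont ?_
    filter_upwards [hY' z, hY, hr.eventually_ge_atTop R] with s hs hYs hRs
    refine hYs.near z (fun i => (hz i).trans (by exact_mod_cast hRs)) ?_ j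
    obtain ⟨I, a, h⟩ := hpres
    exact ⟨I, a, hs.symm ▸ h⟩

/-- The configurations of planar tilings, restricted to boxes. -/
theorem exists_boxConfig {T : Set (Tile v)} (hT : T ∈ coloredTilingSpace F) {E : Plane d n} {t : ℕ}
    (hE : IsPlanar T E t) (C : ℕ) {ι : Fin d → Fin n} {A : Fin d → Fin n → ℝ} (hA : IsReduced ι A)
    (hA1 : ∀ i j, |A i j| ≤ 1) {R : ℕ} (hR : planeDist E hA.plane < 1 / (n * R + 1)) :
    ∃ Y, BoxConfig F C ((d + 1) * (2 * (n * t) + 1)) ι A R Y := by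
  obtain ⟨hT, c, hF⟩ := hT
  obtain ⟨L, hL, hnear⟩ := hE.exists_nearPlane
  obtain ⟨τ₀, hτ₀, -⟩ := hT.exists_mem 0
  let L₀ : (Fin d → ℝ) → Fin n → ℤ := fun p => L p - L τ₀.base
  have hL₀ : IsLift T L₀ := by
    refine ⟨⟨τ₀.base, ⟨τ₀, hτ₀, ∅, Finset.empty_subset _, τ₀.vertex_empty.symm⟩, sub_self _⟩,
      fun τ hτ S hS i hi hiS => ?_⟩
    simp only [L₀, hL.2 τ hτ S hS i hi hiS]
    abel
  obtain ⟨Y, hY⟩ := exists_isConfigOf c hT hL₀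
  refine ⟨Y, fun z _ => ⟨Y, ⟨T, c, L₀, hT, hF, hL₀, hY⟩, z, fun _ _ => rfl⟩,
    ⟨τ₀.dirs, c ⟨τ₀, hτ₀⟩, (hY _ _ _).2 ⟨τ₀, hτ₀, sub_self _, rfl, rfl⟩⟩, ?_⟩
  rintro z hz ⟨I, a, hza⟩ j
  obtain ⟨τ, hτ, rfl, -, -⟩ := (hY _ _ _).1 hza
  obtain ⟨y, hy, hyz⟩ := hnear τ hτ τ₀ hτ₀
  set z := L τ.base - L τ₀.base
  obtain ⟨y', hy', hyy'⟩ := exists_mem_of_planeDist_lt hR hy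
  have hzn : ‖intVec z‖ ≤ n * R := norm_le_of_abs_le (Nat.cast_nonneg R) fun i => by
    have h0 : |z i| ≤ (R : ℤ) := hz i
    have h1 := (Int.cast_le (R := ℝ)).2 h0
    rwa [Int.cast_abs, Int.cast_natCast] at h1
  have hyn : ‖y‖ ≤ n * t + n * R := by
    calc ‖y‖ = ‖intVec z - (intVec z - y)‖ := by congr 1; abel
      _ ≤ _ := norm_sub_le _ _
      _ ≤ _ := by linarith
  have hpos : (0 : ℝ) < n * R + 1 := by positivity
  have h1 : ‖y - y'‖ ≤ n * t + 1 := by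
    refine hyy'.trans ?_
    rw [one_div_mul_eq_div, div_le_iff₀ hpos]
    have h3 : (0 : ℝ) ≤ n * t * (n * R) := by positivity
    nlinarith
  have h2 : ‖intVec z - y'‖ ≤ 2 * (n * t) + 1 := by
    calc ‖intVec z - y'‖ = ‖(intVec z - y) + (y - y')‖ := by congr 1; abel
      _ ≤ _ := norm_add_le _ _
      _ ≤ _ := by linarith
  have := hA.abs_sub_le hA1 hy' h2 j
  simpa using this

open Filter Topology in
/-- For a suitable window size, the planes that carry configurations on all boxes, and are not
too close to the kernel of the projection, are slopes of tilings. -/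
theorem exists_window {𝓔 : Set (Plane d n)} {t : ℕ}
    (hF : ∀ T ∈ coloredTilingSpace F, ∃ E ∈ 𝓔, IsPlanar T E t) {c : ℝ} (hc : 0 < c) {D : ℝ}
    (hD : 0 ≤ D) :
    ∃ C : ℕ, ∀ (ι : Fin d → Fin n) (A : ℕ → Fin d → Fin n → ℝ) (A' : Fin d → Fin n → ℝ)
      (h' : IsReduced ι A') (r : ℕ → ℕ) (l : Ultrafilter ℕ), Tendsto r l atTop →
      (∀ᶠ s in l, ∃ Y, BoxConfig F C D ι (A s) (r s) Y) →
      (∀ i j, Tendsto (fun s => A s i j) l (𝓝 (A' i j))) →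
      (∀ y ∈ h'.plane.1, ‖y‖ ≤ c * ‖proj v y‖) → h'.plane ∈ 𝓔 := by
  obtain ⟨K, hK⟩ := exists_lift_bound v
  obtain ⟨R₁, hR₁⟩ : ∃ R₁ : ℝ, ∀ P ∈ F, ∀ a ∈ P, ∀ b ∈ P, ‖a.1.base - b.1.base‖ ≤ R₁ := by
    refine ⟨∑ P ∈ F, ∑ a ∈ P, ∑ b ∈ P, ‖a.1.base - b.1.base‖, fun P hP a ha b hb => ?_⟩
    refine le_trans ?_ (Finset.single_le_sum (f := fun P : Finset (Tile v × Fin k) =>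
      ∑ a ∈ P, ∑ b ∈ P, ‖a.1.base - b.1.base‖) (fun _ _ => by positivity) hP)
    refine le_trans ?_ (Finset.single_le_sum (f := fun a : Tile v × Fin k =>
      ∑ b ∈ P, ‖a.1.base - b.1.base‖) (fun _ _ => by positivity) ha)
    exact Finset.single_le_sum (f := fun b : Tile v × Fin k => ‖a.1.base - b.1.base‖)
      (fun _ _ => by positivity) hb
  set R₀ := max R₁ (2 * diamBound v) with hR₀
  -- the lifts of two tiles with bases at distance at most `R₀`, both at distance at most `n * D`
  -- from a plane that satisfies the bound with constant `c`, differ by at most this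
  obtain ⟨C, hC⟩ := exists_nat_ge
    (max (K : ℝ) (c * (R₀ + diamBound v * (2 * (n * D))) + 2 * (n * D)))
  refine ⟨C, fun ι A A' h' r l hr hY hA hslope => ?_⟩
  have hY₁ : ∃ Y : ℕ → Config n k, ∀ᶠ s in l, BoxConfig F C D ι (A s) (r s) (Y s) := by
    classical
    refine ⟨fun s => if h : ∃ Y, BoxConfig F C D ι (A s) (r s) Y then h.choose else fun _ _ => none,
      ?_⟩
    filter_upwards [hY] with s hs
    rw [dif_pos hs]
    exact hs.choose_spec
  obtain ⟨Y₁, hY₁⟩ := hY₁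
  obtain ⟨Y, hbox⟩ := exists_limit_config l hr hY₁ hA
  have hbound : ∀ z : Fin n → ℤ, ∃ R : ℕ, ∀ i, |z i| + C ≤ R := by
    intro z
    refine ⟨∑ i, (z i).natAbs + C, fun i => ?_⟩
    have : (z i).natAbs ≤ ∑ i, (z i).natAbs :=
      Finset.single_le_sum (f := fun i => (z i).natAbs) (fun _ _ => Nat.zero_le _)
        (Finset.mem_univ i)
    rw [Int.abs_eq_natAbs]
    push_cast
    have h2 : ((z i).natAbs : ℤ) ≤ ∑ i, ((z i).natAbs : ℤ) := by exact_mod_cast this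
    linarith
  have hnear : ∀ z, Present Y z → ∃ y ∈ rowSpan A', ‖intVec z - y‖ ≤ n * D := by
    intro z hz
    obtain ⟨R, hR⟩ := hbound z
    refine h'.exists_mem_rowSpan hD fun j => ?_
    have := (hbox R).near z (fun i => by have := hR i; omega) hz j
    simpa using this
  have hgood : GoodConfig F C R₀ Y := by
    refine ⟨fun z => ?_, fun z z' hz hz' hzz' j => ?_⟩
    · obtain ⟨R, hR⟩ := hbound z
      exact (hbox R).locallyValid z hR
    · obtain ⟨y, hy, hyz⟩ := hnear z hz
      obtain ⟨y', hy', hyz'⟩ := hnear z' hz'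
      have h1 : ‖intVec (z - z') - (y - y')‖ ≤ 2 * (n * D) := by
        rw [intVec_sub, sub_sub_sub_comm]
        exact (norm_sub_le _ _).trans (by linarith)
      have h2 : ‖proj v (intVec (z - z') - (y - y'))‖ ≤ diamBound v * (2 * (n * D)) :=
        (norm_proj_le _).trans (mul_le_mul_of_nonneg_left h1 (diamBound_nonneg v))
      have h3 : ‖proj v (y - y')‖ ≤ R₀ + diamBound v * (2 * (n * D)) := by
        calc ‖proj v (y - y')‖ =
            ‖proj v (intVec (z - z')) - proj v (intVec (z - z') - (y - y'))‖ := by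
              rw [map_sub (proj v) (intVec (z - z'))]; congr 1; abel
          _ ≤ _ := norm_sub_le _ _
          _ ≤ _ := by linarith
      have h4 := (hslope _ (h'.plane.1.sub_mem hy hy')).trans (mul_le_mul_of_nonneg_left h3 hc.le)
      have h5 : ‖intVec (z - z')‖ ≤ C := by
        calc ‖intVec (z - z')‖ = ‖(intVec (z - z') - (y - y')) + (y - y')‖ := by congr 1; abel
          _ ≤ _ := norm_add_le _ _
          _ ≤ c * (R₀ + diamBound v * (2 * (n * D))) + 2 * (n * D) := by linarith
          _ ≤ C := (le_max_right _ _).trans hC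
      have h6 := (abs_apply_le_norm (intVec (z - z')) j).trans h5
      rw [intVec_apply, Pi.sub_apply, ← Int.cast_abs, ← Int.cast_natCast] at h6
      exact Int.cast_le.1 h6
  have hKC : (K : ℤ) ≤ C := by
    have : (K : ℝ) ≤ C := (le_max_left _ _).trans hC
    exact_mod_cast this
  obtain ⟨T, hT, L, hL, hTE⟩ := hgood.exists_tiling (le_max_right _ _)
    (fun T hT L hL τ hτ σ hσ x hx y hy hxy j => by
      have := hK T hT L hL 0 τ hτ σ hσ x hx y hy (by simpa using hxy) j
      simp only [Nat.cast_zero, zero_add, mul_one] at this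
      exact this.trans hKC)
    (fun P hP a ha b hb => (hR₁ P hP a ha b hb).trans (le_max_left _ _))
    (hbox 0).present hnear
  obtain ⟨E, hE, hTE'⟩ := hF T hT
  obtain ⟨L', hL', hnear'⟩ := hTE'.exists_nearPlane
  have : h'.plane = E := IsTiling.plane_eq hT.1 hL hL' (E := h'.plane) hTE hnear'
  exact this ▸ hE

end Configurations

/-! ### Decidability of the existence of a configuration on a box -/

section Coding

/-- The digit of rank `i` of `p` in base `b`. -/
def digit (b p i : ℕ) : ℕ := p / b ^ i % b

theorem digit_lt {b : ℕ} (hb : 0 < b) (p i : ℕ) : digit b p i < b := Nat.mod_lt _ hb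

/-- The number with given digits in base `b`. -/
def ofDigitFun {m : ℕ} (b : ℕ) (q : Fin m → ℕ) : ℕ := ∑ i, q i * b ^ (i : ℕ)

theorem ofDigitFun_eq {m b : ℕ} {q : Fin m → ℕ} (hq : ∀ i, q i < b) :
    ofDigitFun b q = finFunctionFinEquiv fun i => (⟨q i, hq i⟩ : Fin b) := by
  rw [finFunctionFinEquiv_apply]
  rfl

theorem ofDigitFun_lt {m b : ℕ} {q : Fin m → ℕ} (hq : ∀ i, q i < b) : ofDigitFun b q < b ^ m := by
  rw [ofDigitFun_eq hq]
  exact Fin.is_lt _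

theorem digit_ofDigitFun {m b : ℕ} {q : Fin m → ℕ} (hq : ∀ i, q i < b) (i : Fin m) :
    digit b (ofDigitFun b q) i = q i := by
  have h := congrArg (fun f : Fin m → Fin b => (f i : ℕ))
    (finFunctionFinEquiv.symm_apply_apply fun i => (⟨q i, hq i⟩ : Fin b))
  rw [ofDigitFun_eq hq]
  exact h

theorem ofDigitFun_digit {m b p : ℕ} (hp : p < b ^ m) :
    ofDigitFun b (fun i : Fin m => digit b p i) = p := by
  have h := congrArg Fin.val (finFunctionFinEquiv.apply_symm_apply (⟨p, hp⟩ : Fin (b ^ m)))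
  rw [finFunctionFinEquiv_apply] at h
  exact h

variable {α : Type*} [Primcodable α]

theorem primrec_digit {f g h : α → ℕ} (hf : Primrec f) (hg : Primrec g) (hh : Primrec h) :
    Primrec fun x => digit (f x) (g x) (h x) :=
  Primrec.nat_mod.comp (Primrec.nat_div.comp hg (primrec_pow hf hh)) hf

theorem primrec_add {f g : α → ℕ} (hf : Primrec f) (hg : Primrec g) :
    Primrec fun x => f x + g x := Primrec.nat_add.comp hf hg

theorem primrec_mul {f g : α → ℕ} (hf : Primrec f) (hg : Primrec g) :
    Primrec fun x => f x * g x := Primrec.nat_mul.comp hf hg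

theorem primrecPred_le {f g : α → ℕ} (hf : Primrec f) (hg : Primrec g) :
    PrimrecPred fun x => f x ≤ g x := Primrec.nat_le.comp hf hg

theorem primrecPred_lt {f g : α → ℕ} (hf : Primrec f) (hg : Primrec g) :
    PrimrecPred fun x => f x < g x := Primrec.nat_lt.comp hf hg

theorem primrecPred_imp {p q : α → Prop} (hp : PrimrecPred p) (hq : PrimrecPred q) :
    PrimrecPred fun x => p x → q x :=
  (hp.not.or hq).of_eq fun x => by tauto

end Coding

section Algorithm

variable {n d k : ℕ} {v : Fin n → Fin d → ℝ}

/-- The denominators of the rational matrices used at scale `R` are `gridDen n R + 1`. -/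
def gridDen (n R : ℕ) : ℕ := n * n * (n * R + 1)

/-- The base used to code, at scale `R`, the numerators of a matrix by the digits of a number. -/
def gridBase (n R : ℕ) : ℕ := 2 * (gridDen n R + 1) + 1

/-- The numerators coded by `a` at scale `R`. -/
def gridNum (n d R a : ℕ) (i : Fin d) (j : Fin n) : ℕ :=
  digit (gridBase n R) a (finProdFinEquiv (i, j))

theorem gridNum_le (n d R a : ℕ) (i : Fin d) (j : Fin n) :
    gridNum n d R a i j ≤ 2 * (gridDen n R + 1) :=
  Nat.lt_succ_iff.1 (digit_lt (Nat.succ_pos _) _ _)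

theorem exists_gridNum_eq {R : ℕ} {α : Fin d → Fin n → ℕ}
    (hα : ∀ i j, α i j ≤ 2 * (gridDen n R + 1)) :
    ∃ a < gridBase n R ^ (d * n), gridNum n d R a = α := by
  have hq : ∀ l : Fin (d * n),
      α (finProdFinEquiv.symm l).1 (finProdFinEquiv.symm l).2 < gridBase n R :=
    fun l => Nat.lt_succ_of_le (hα _ _)
  refine ⟨_, ofDigitFun_lt hq, ?_⟩
  ext i j
  rw [gridNum, digit_ofDigitFun hq, Equiv.symm_apply_apply]

/-- The rational matrix coded by `a` at scale `R`. -/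
def gridMat (ι : Fin d → Fin n) (R a : ℕ) : Fin d → Fin n → ℝ :=
  gridMatrix ι (gridDen n R) (gridNum n d R a)

/-- The test passed by the rational plane coded by `x.2` at scale `x.1`: there is a configuration
near this plane on the box of radius `x.1`. -/
def HasConfig (F : Finset (Finset (Tile v × Fin k))) (C D : ℕ) (ι : Fin d → Fin n) (x : ℕ × ℕ) :
    Prop :=
  ∃ Y, BoxConfig F C D ι (gridMat ι x.1 x.2) x.1 Y

/-- The point of the box of radius `R` whose coordinates, shifted by `R`, are the digits of `p`. -/
def boxPoint (n R p : ℕ) : Fin n → ℤ := fun i => (digit (2 * R + 1) p i : ℤ) - R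

theorem abs_boxPoint_le (n R p : ℕ) (i : Fin n) : |boxPoint n R p i| ≤ R := by
  have := digit_lt (Nat.succ_pos (2 * R)) p i
  simp only [Nat.succ_eq_add_one] at this
  rw [boxPoint, abs_le]
  omega

/-- The number of a point of the box. -/
def boxIndex (R : ℕ) (z : Fin n → ℤ) : ℕ := ofDigitFun (2 * R + 1) fun i => (z i + R).toNat

theorem boxIndex_lt {R : ℕ} {z : Fin n → ℤ} (hz : ∀ i, |z i| ≤ R) :
    boxIndex R z < (2 * R + 1) ^ n :=
  ofDigitFun_lt fun i => by have := abs_le.1 (hz i); omega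

theorem boxPoint_boxIndex {R : ℕ} {z : Fin n → ℤ} (hz : ∀ i, |z i| ≤ R) :
    boxPoint n R (boxIndex R z) = z := by
  ext i
  rw [boxPoint, boxIndex, digit_ofDigitFun fun i => by have := abs_le.1 (hz i); omega]
  have := abs_le.1 (hz i)
  omega

theorem boxIndex_boxPoint {R p : ℕ} (hp : p < (2 * R + 1) ^ n) :
    boxIndex R (boxPoint n R p) = p := by
  conv_rhs => rw [← ofDigitFun_digit hp]
  rw [boxIndex]
  congr 1
  ext i
  simp [boxPoint]

/-- The possible values of configurations, numbered. -/
def symbolEquiv (n k : ℕ) : (Finset (Fin n) → Option (Fin k)) ≃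
    Fin (Fintype.card (Finset (Fin n) → Option (Fin k))) := Fintype.equivFin _

/-- The number of values of configurations. -/
def numSymbols (n k : ℕ) : ℕ := Fintype.card (Finset (Fin n) → Option (Fin k))

theorem numSymbols_pos (n k : ℕ) : 0 < numSymbols n k :=
  Fintype.card_pos_iff.2 ⟨fun _ => none⟩

/-- The number of a value of a configuration. -/
def symbolCode (s : Finset (Fin n) → Option (Fin k)) : ℕ := symbolEquiv n k s

theorem symbolCode_lt (s : Finset (Fin n) → Option (Fin k)) : symbolCode s < numSymbols n k :=
  (symbolEquiv n k s).2

theorem symbolCode_injective : Function.Injective (symbolCode (n := n) (k := k)) :=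
  Fin.val_injective.comp (symbolEquiv n k).injective

theorem exists_symbolCode_eq {a : ℕ} (ha : a < numSymbols n k) :
    ∃ s : Finset (Fin n) → Option (Fin k), symbolCode s = a :=
  ⟨(symbolEquiv n k).symm ⟨a, ha⟩, by simp [symbolCode]⟩

/-- The windows that appear in valid configurations, indexed from their lowest corner. -/
def validWindows (F : Finset (Finset (Tile v × Fin k))) (C : ℕ) :
    Set ((Fin n → Fin (2 * C + 1)) → Finset (Fin n) → Option (Fin k)) :=
  {W | ∃ X, ValidConfig F X ∧ ∃ w : Fin n → ℤ, ∀ δ, W δ = X fun i => w i + (δ i : ℕ) - C}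

/-- The conditions of `BoxConfig` on a configuration of the box coded by the number `N`, as
inequalities between natural numbers. -/
def CodeValid (F : Finset (Finset (Tile v × Fin k))) (C D : ℕ) (ι : Fin d → Fin n) (R a N : ℕ) :
    Prop :=
  (∀ p < (2 * R + 1) ^ n, (∀ i : Fin n, digit (2 * R + 1) p i + 2 * C < 2 * R + 1) →
    ∃ W : validWindows F C, ∀ δ : Fin n → Fin (2 * C + 1),
      digit (numSymbols n k) N (p + ofDigitFun (2 * R + 1) fun i => (δ i : ℕ)) =
        symbolCode (W.1 δ)) ∧
  (∃ s : {s : Finset (Fin n) → Option (Fin k) // ∃ I a, s I = some a},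
    digit (numSymbols n k) N (ofDigitFun (2 * R + 1) fun _ : Fin n => R) = symbolCode s.1) ∧
  ∀ p < (2 * R + 1) ^ n,
    (∃ s : {s : Finset (Fin n) → Option (Fin k) // ∃ I a, s I = some a},
      digit (numSymbols n k) N p = symbolCode s.1) →
    ∀ j : {j // j ∉ range ι},
      (gridDen n R + 1) * digit (2 * R + 1) p j +
          ∑ i, ((gridDen n R + 1) * digit (2 * R + 1) p (ι i) + R * gridNum n d R a i j) ≤
        D * (gridDen n R + 1) + ((gridDen n R + 1) * R +
          ∑ i, (digit (2 * R + 1) p (ι i) * gridNum n d R a i j + R * (gridDen n R + 1))) ∧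
      (gridDen n R + 1) * R +
          ∑ i, (digit (2 * R + 1) p (ι i) * gridNum n d R a i j + R * (gridDen n R + 1)) ≤
        D * (gridDen n R + 1) + ((gridDen n R + 1) * digit (2 * R + 1) p j +
          ∑ i, ((gridDen n R + 1) * digit (2 * R + 1) p (ι i) + R * gridNum n d R a i j))

variable {F : Finset (Finset (Tile v × Fin k))} {C D : ℕ} {ι : Fin d → Fin n}

/-- The equations of a rational plane, with denominators cleared. -/
theorem near_iff (hι : Function.Injective ι) (R a p : ℕ) :
    (∀ j, |(boxPoint n R p j : ℝ) - ∑ i, (boxPoint n R p (ι i) : ℝ) * gridMat ι R a i j| ≤ D) ↔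
    ∀ j : {j // j ∉ range ι},
      (gridDen n R + 1) * digit (2 * R + 1) p j +
          ∑ i, ((gridDen n R + 1) * digit (2 * R + 1) p (ι i) + R * gridNum n d R a i j) ≤
        D * (gridDen n R + 1) + ((gridDen n R + 1) * R +
          ∑ i, (digit (2 * R + 1) p (ι i) * gridNum n d R a i j + R * (gridDen n R + 1))) ∧
      (gridDen n R + 1) * R +
          ∑ i, (digit (2 * R + 1) p (ι i) * gridNum n d R a i j + R * (gridDen n R + 1)) ≤
        D * (gridDen n R + 1) + ((gridDen n R + 1) * digit (2 * R + 1) p j +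
          ∑ i, ((gridDen n R + 1) * digit (2 * R + 1) p (ι i) + R * gridNum n d R a i j)) := by
  -- the equations of the columns in the identity block are trivial
  have hsplit : (∀ j, |(boxPoint n R p j : ℝ) -
        ∑ i, (boxPoint n R p (ι i) : ℝ) * gridMat ι R a i j| ≤ D) ↔
      ∀ j : {j // j ∉ range ι}, |(boxPoint n R p j : ℝ) -
        ∑ i, (boxPoint n R p (ι i) : ℝ) * gridMat ι R a i j| ≤ D := by
    refine ⟨fun h j => h j, fun h j => ?_⟩
    by_cases hj : j ∈ range ι
    · obtain ⟨i', rfl⟩ := hj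
      have hred := isReduced_gridMatrix hι (gridDen n R) (gridNum n d R a)
      have : ∀ i, gridMat ι R a i (ι i') = if i = i' then 1 else 0 := fun i => hred i i'
      simp [this]
    · exact h ⟨j, hj⟩
  rw [hsplit]
  refine forall_congr' fun ⟨j, hj⟩ => ?_
  simp only [gridMat, gridMatrix_of_notMem hj, boxPoint]
  set M : ℕ := gridDen n R + 1 with hM
  have hMpos : (0 : ℝ) < M := by positivity
  have hMr : ((gridDen n R : ℕ) : ℝ) + 1 = M := by rw [hM]; push_cast; ring
  set X : ℝ := ((M * digit (2 * R + 1) p j +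
    ∑ i, (M * digit (2 * R + 1) p (ι i) + R * gridNum n d R a i j) : ℕ) : ℝ) with hX
  set Z : ℝ := ((M * R +
    ∑ i, (digit (2 * R + 1) p (ι i) * gridNum n d R a i j + R * M) : ℕ) : ℝ) with hZ
  have key : M * ((((digit (2 * R + 1) p j : ℤ) - (R : ℤ) : ℤ) : ℝ) -
      ∑ i, (((digit (2 * R + 1) p (ι i) : ℤ) - (R : ℤ) : ℤ) : ℝ) *
        (gridNum n d R a i j / ((gridDen n R : ℕ) + 1) - 1)) = X - Z := by
    rw [hX, hZ, hMr]
    push_cast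
    rw [mul_sub, Finset.mul_sum, add_sub_add_comm, ← Finset.sum_sub_distrib, mul_sub,
      sub_eq_add_neg _ (∑ i, _), ← Finset.sum_neg_distrib]
    congr 1
    refine Finset.sum_congr rfl fun i _ => ?_
    field_simp
    ring
  rw [← mul_le_mul_iff_right₀ hMpos, ← abs_of_pos hMpos, ← abs_mul, abs_of_pos hMpos, key, abs_le,
    ← Nat.cast_le (α := ℝ), ← Nat.cast_le (α := ℝ), Nat.cast_add (D * M), Nat.cast_add (D * M),
    ← hX, ← hZ, Nat.cast_mul]
  constructor
  · rintro ⟨h1, h2⟩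
    exact ⟨by linarith, by linarith⟩
  · rintro ⟨h1, h2⟩
    exact ⟨by linarith, by linarith⟩

/-- If a window with lowest corner `p` fits in the box, adding the numbers of the corner and of an
offset involves no carry, so that it adds the coordinates. -/
theorem add_ofDigitFun {R p : ℕ} (hp : p < (2 * R + 1) ^ n)
    (h : ∀ i : Fin n, digit (2 * R + 1) p i + 2 * C < 2 * R + 1) (δ : Fin n → Fin (2 * C + 1)) :
    p + (ofDigitFun (2 * R + 1) fun i => (δ i : ℕ)) < (2 * R + 1) ^ n ∧
    boxPoint n R (p + ofDigitFun (2 * R + 1) fun i => (δ i : ℕ)) =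
      fun i => boxPoint n R p i + (δ i : ℕ) := by
  have hq : ∀ i : Fin n, digit (2 * R + 1) p i + δ i < 2 * R + 1 := fun i => by
    have := h i
    have := (δ i).2
    omega
  have he : p + (ofDigitFun (2 * R + 1) fun i => (δ i : ℕ)) =
      ofDigitFun (2 * R + 1) fun i : Fin n => digit (2 * R + 1) p i + δ i := by
    conv_lhs => rw [← ofDigitFun_digit hp]
    simp only [ofDigitFun, ← Finset.sum_add_distrib, add_mul]
  rw [he]
  refine ⟨ofDigitFun_lt hq, ?_⟩
  ext i
  rw [boxPoint, digit_ofDigitFun hq, boxPoint]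
  push_cast
  ring

/-- The test is a bounded search over numbers that code configurations of the box. -/
theorem hasConfig_iff (hι : Function.Injective ι) (x : ℕ × ℕ) :
    HasConfig F C D ι x ↔
      ∃ N < numSymbols n k ^ ((2 * x.1 + 1) ^ n), CodeValid F C D ι x.1 x.2 N := by
  obtain ⟨R, a⟩ := x
  set B := 2 * R + 1 with hB
  have hcenter : boxPoint n R (ofDigitFun B fun _ : Fin n => R) = 0 := by
    ext i
    rw [boxPoint, digit_ofDigitFun fun _ => by omega]
    simp
  have hcenter_lt : (ofDigitFun B fun _ : Fin n => R) < B ^ n := ofDigitFun_lt fun _ => by omega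
  constructor
  · rintro ⟨Y, hY⟩
    have hq : ∀ p : Fin (B ^ n), symbolCode (Y (boxPoint n R p)) < numSymbols n k :=
      fun p => symbolCode_lt _
    refine ⟨_, ofDigitFun_lt hq, ?_⟩
    have hdig : ∀ p < B ^ n, digit (numSymbols n k) (ofDigitFun (numSymbols n k)
        fun p : Fin (B ^ n) => symbolCode (Y (boxPoint n R p))) p =
        symbolCode (Y (boxPoint n R p)) := fun p hp => digit_ofDigitFun hq ⟨p, hp⟩
    refine ⟨fun p hp hpC => ?_, ?_, fun p hp ⟨s, hs⟩ => ?_⟩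
    · obtain ⟨X, hX, w, hw⟩ := hY.locallyValid (fun i => boxPoint n R p i + C) fun i => by
        have h1 : digit B p i + 2 * C < 2 * R + 1 := hpC i
        have h2 : |(digit B p i : ℤ) - R + C| ≤ (R : ℤ) - C := abs_le.2 ⟨by omega, by omega⟩
        change |(digit B p i : ℤ) - R + C| + C ≤ (R : ℤ)
        linarith
      refine ⟨⟨fun δ => X fun i => w i + (δ i : ℕ) - C, X, hX, w, fun δ => rfl⟩, fun δ => ?_⟩
      obtain ⟨h1, h2⟩ := add_ofDigitFun hp hpC δ
      rw [hdig _ h1, h2]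
      have h3 := hw (fun i => (δ i : ℕ) - C) fun i => by
        have := (δ i).2
        exact abs_le.2 ⟨by omega, by omega⟩
      congr 1
      convert h3 using 2
      · ext i
        simp
      · ext i
        simp [add_sub_assoc]
    · refine ⟨⟨Y 0, hY.present⟩, ?_⟩
      rw [hdig _ hcenter_lt, hcenter]
    · rw [hdig _ hp] at hs
      refine (near_iff hι R a p).1 (hY.near _ (abs_boxPoint_le n R p) ?_)
      rw [Present, symbolCode_injective hs]
      exact s.2
  · rintro ⟨N, -, hW, hP, hnear⟩
    have hsym : ∀ p, ∃ s : Finset (Fin n) → Option (Fin k),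
        symbolCode s = digit (numSymbols n k) N p :=
      fun p => exists_symbolCode_eq (digit_lt (numSymbols_pos n k) _ _)
    choose sym hsym using hsym
    refine ⟨fun z => sym (boxIndex R z), ⟨fun z hz => ?_, ?_, fun z hz hpres => ?_⟩⟩
    · set z₀ : Fin n → ℤ := fun i => z i - C with hz₀
      have hz' : ∀ i, |z i| ≤ R - C := fun i => by
        have h0 : |z i| + C ≤ (R : ℤ) := hz i
        linarith
      have hz₀R : ∀ i, |z₀ i| ≤ R := fun i => by
        have := abs_le.1 (hz' i)
        exact abs_le.2 ⟨by simp only [hz₀]; omega, by simp only [hz₀]; omega⟩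
      have hp : boxIndex R z₀ < B ^ n := boxIndex_lt hz₀R
      have hpC : ∀ i : Fin n, digit B (boxIndex R z₀) i + 2 * C < B := fun i => by
        have h1 : (digit B (boxIndex R z₀) i : ℤ) - R = z i - C :=
          congrFun (boxPoint_boxIndex hz₀R) i
        have h2 := abs_le.1 (hz' i)
        omega
      obtain ⟨⟨W, X, hX, w, hw⟩, hWδ⟩ := hW _ hp hpC
      refine ⟨X, hX, w, fun δ hδ => ?_⟩
      let δ' : Fin n → Fin (2 * C + 1) := fun i => ⟨(δ i + C).toNat, by
        have := abs_le.1 (hδ i); omega⟩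
      have hδ' : ∀ i, ((δ' i : ℕ) : ℤ) = δ i + C := fun i => by
        have := abs_le.1 (hδ i)
        simp only [δ']
        omega
      obtain ⟨h1, h2⟩ := add_ofDigitFun hp hpC δ'
      have h3 := hWδ δ'
      rw [boxPoint_boxIndex hz₀R] at h2
      have h4 : (fun i => z₀ i + ((δ' i : ℕ) : ℤ)) = z + δ := by
        ext i
        rw [hδ', Pi.add_apply]
        simp only [hz₀]
        ring
      have h5 : boxIndex R (z + δ) =
          boxIndex R z₀ + ofDigitFun B fun i => (δ' i : ℕ) := by
        rw [← h4, ← h2, boxIndex_boxPoint h1]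
      change sym (boxIndex R (z + δ)) = _
      rw [h5]
      refine symbolCode_injective ?_
      rw [hsym]
      refine h3.trans ?_
      change symbolCode (W δ') = _
      rw [hw]
      congr 2
      ext i
      rw [hδ', Pi.add_apply]
      ring
    · obtain ⟨s, hs⟩ := hP
      have h1 : boxIndex R (0 : Fin n → ℤ) = ofDigitFun B fun _ : Fin n => R := by
        rw [← hcenter, boxIndex_boxPoint hcenter_lt]
      change ∃ I a, sym (boxIndex R 0) I = some a
      rw [h1, symbolCode_injective ((hsym _).trans hs)]
      exact s.2
    · have h1 := (near_iff hι R a (boxIndex R z)).2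
        (hnear _ (boxIndex_lt hz) ⟨⟨_, hpres⟩, (hsym _).symm⟩)
      rwa [boxPoint_boxIndex hz] at h1

theorem primrec_gridDen {α : Type*} [Primcodable α] {f : α → ℕ} (hf : Primrec f) :
    Primrec fun x => gridDen n (f x) :=
  primrec_mul (Primrec.const _) (primrec_add (primrec_mul (Primrec.const _) hf) (Primrec.const _))

theorem primrec_gridBase {α : Type*} [Primcodable α] {f : α → ℕ} (hf : Primrec f) :
    Primrec fun x => gridBase n (f x) :=
  primrec_add (primrec_mul (Primrec.const _) (primrec_add (primrec_gridDen hf) (Primrec.const _)))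
    (Primrec.const _)

theorem primrec_gridNum {α : Type*} [Primcodable α] {f g : α → ℕ} (hf : Primrec f)
    (hg : Primrec g) (i : Fin d) (j : Fin n) : Primrec fun x => gridNum n d (f x) (g x) i j :=
  primrec_digit (primrec_gridBase hf) hg (Primrec.const _)

theorem primrec_ofDigitFun {α : Type*} [Primcodable α] {m : ℕ} {b : α → ℕ} {q : Fin m → α → ℕ}
    (hb : Primrec b) (hq : ∀ i, Primrec (q i)) :
    Primrec fun x => ofDigitFun (b x) fun i => q i x :=
  primrec_sum fun i => primrec_mul (hq i) (primrec_pow hb (Primrec.const _))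

theorem primrecPred_codeValid :
    PrimrecPred fun x : (ℕ × ℕ) × ℕ => CodeValid F C D ι x.1.1 x.1.2 x.2 := by
  have hB : ∀ {α : Type} [Primcodable α] {f : α → ℕ}, Primrec f →
      Primrec fun x => 2 * f x + 1 := fun hf =>
    primrec_add (primrec_mul (Primrec.const _) hf) (Primrec.const _)
  have hR : Primrec fun x : (ℕ × ℕ) × ℕ => x.1.1 := Primrec.fst.comp Primrec.fst
  have hR' : Primrec fun x : ((ℕ × ℕ) × ℕ) × ℕ => x.1.1.1 := hR.comp Primrec.fst
  have ha' : Primrec fun x : ((ℕ × ℕ) × ℕ) × ℕ => x.1.1.2 :=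
    Primrec.snd.comp (Primrec.fst.comp Primrec.fst)
  have hN' : Primrec fun x : ((ℕ × ℕ) × ℕ) × ℕ => x.1.2 := Primrec.snd.comp Primrec.fst
  have hp' : Primrec fun x : ((ℕ × ℕ) × ℕ) × ℕ => x.2 := Primrec.snd
  have hBn : Primrec fun x : (ℕ × ℕ) × ℕ => (2 * x.1.1 + 1) ^ n :=
    primrec_pow (hB hR) (Primrec.const _)
  have hM : Primrec fun x : ((ℕ × ℕ) × ℕ) × ℕ => gridDen n x.1.1.1 + 1 :=
    primrec_add (primrec_gridDen hR') (Primrec.const _)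
  have hdig : ∀ i : ℕ, Primrec fun x : ((ℕ × ℕ) × ℕ) × ℕ => digit (2 * x.1.1.1 + 1) x.2 i :=
    fun i => primrec_digit (hB hR') hp' (Primrec.const i)
  have hnum : ∀ (i : Fin d) (j : Fin n),
      Primrec fun x : ((ℕ × ℕ) × ℕ) × ℕ => gridNum n d x.1.1.1 x.1.1.2 i j :=
    fun i j => primrec_gridNum hR' ha' i j
  refine PrimrecPred.and (primrecPred_forall_lt hBn (primrecPred_imp
    (primrecPred_forall_finite fun i => primrecPred_lt (primrec_add (hdig i) (Primrec.const _))
      (hB hR')) (primrecPred_exists_finite fun W => primrecPred_forall_finite fun δ =>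
        Primrec.eq.comp (primrec_digit (Primrec.const _) hN' (primrec_add hp'
          (primrec_ofDigitFun (hB hR') fun i => Primrec.const _))) (Primrec.const _))))
    (PrimrecPred.and (primrecPred_exists_finite fun s => Primrec.eq.comp
      (primrec_digit (Primrec.const _) Primrec.snd (primrec_ofDigitFun (hB hR) fun _ => hR))
      (Primrec.const _)) (primrecPred_forall_lt hBn (primrecPred_imp
        (primrecPred_exists_finite fun s => Primrec.eq.comp
          (primrec_digit (Primrec.const _) hN' hp') (Primrec.const _))
        (primrecPred_forall_finite fun j => ?_))))
  have hX : Primrec fun x : ((ℕ × ℕ) × ℕ) × ℕ =>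
      (gridDen n x.1.1.1 + 1) * digit (2 * x.1.1.1 + 1) x.2 j +
        ∑ i, ((gridDen n x.1.1.1 + 1) * digit (2 * x.1.1.1 + 1) x.2 (ι i) +
          x.1.1.1 * gridNum n d x.1.1.1 x.1.1.2 i j) :=
    primrec_add (primrec_mul hM (hdig _)) (primrec_sum fun i =>
      primrec_add (primrec_mul hM (hdig _)) (primrec_mul hR' (hnum i j)))
  have hZ : Primrec fun x : ((ℕ × ℕ) × ℕ) × ℕ => (gridDen n x.1.1.1 + 1) * x.1.1.1 +
      ∑ i, (digit (2 * x.1.1.1 + 1) x.2 (ι i) * gridNum n d x.1.1.1 x.1.1.2 i j +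
        x.1.1.1 * (gridDen n x.1.1.1 + 1)) :=
    primrec_add (primrec_mul hM hR') (primrec_sum fun i =>
      primrec_add (primrec_mul (hdig _) (hnum i j)) (primrec_mul hR' hM))
  have hD : Primrec fun x : ((ℕ × ℕ) × ℕ) × ℕ => D * (gridDen n x.1.1.1 + 1) :=
    primrec_mul (Primrec.const _) hM
  exact PrimrecPred.and (primrecPred_le hX (primrec_add hD hZ))
    (primrecPred_le hZ (primrec_add hD hX))

theorem primrecPred_hasConfig (hι : Function.Injective ι) : PrimrecPred (HasConfig F C D ι) := by
  have hbound : Primrec fun x : ℕ × ℕ => numSymbols n k ^ ((2 * x.1 + 1) ^ n) :=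
    primrec_pow (Primrec.const _) (primrec_pow (primrec_add (primrec_mul (Primrec.const _)
      Primrec.fst) (Primrec.const _)) (Primrec.const _))
  refine (primrecPred_forall_lt (p := fun x N => ¬ CodeValid F C D ι x.1 x.2 N) hbound
    (primrecPred_codeValid (F := F) (C := C) (D := D) (ι := ι)).not).not.of_eq fun x => ?_
  rw [hasConfig_iff hι]
  push Not
  rfl

theorem primrec_gridCode {α : Type*} [Primcodable α] {f g : α → ℕ} (hf : Primrec f)
    (hg : Primrec g) (ι : Fin d → Fin n) :
    Primrec fun x => gridCode ι (gridDen n (f x)) (gridNum n d (f x) (g x)) := by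
  classical
  refine primrec_fin_arrow fun i => primrec_fin_arrow fun j => ?_
  simp only [gridCode]
  by_cases hj : j ∈ range ι
  · simp only [hj, if_true]
    exact Primrec.const _
  · simp only [hj, if_false]
    exact (primrec_gridNum hf hg i j).pair
      ((primrec_add (primrec_gridDen hf) (Primrec.const 1)).pair (primrec_gridDen hf))

end Algorithm

/-! ### Reduction to colored weakened local rules -/

section Reduction

variable {n d : ℕ} {v : Fin n → Fin d → ℝ}

theorem IsPlanar.mono {T : Set (Tile v)} {E : Plane d n} {s t : ℕ} (h : IsPlanar T E s)
    (hst : s ≤ t) : IsPlanar T E t := by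
  obtain ⟨A, hA, L, hL, hsub⟩ := h
  refine ⟨A, hA, L, hL, fun x hx => ?_⟩
  obtain ⟨y, hy, hxy⟩ := hsub hx
  exact ⟨y, hy, fun i => ⟨(hxy i).1, (hxy i).2.trans (Nat.cast_le.2 hst)⟩⟩

theorem Enforces.weakened {ρ : RuleType} {t : ℕ} (ht : 1 ≤ t) {X : Set (Set (Tile v))}
    {𝓔 : Set (Plane d n)} (h : Enforces ρ t X 𝓔) : Enforces .weakened t X 𝓔 := by
  have h1 : ρ.existenceThickness t ≤ t := by
    cases ρ <;> simp [RuleType.existenceThickness, ht]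
  have h2 : ρ.uniformThickness t ≤ t := by
    cases ρ <;> simp [RuleType.uniformThickness, ht]
  refine ⟨fun E hE => ?_, fun T hT => ?_⟩
  · obtain ⟨T, hT, hTE⟩ := h.1 E hE
    exact ⟨T, hT, hTE.mono h1⟩
  · obtain ⟨E, hE, hTE⟩ := h.2 T hT
    exact ⟨E, hE, hTE.mono h2⟩

theorem exists_coloredTilingSpace_eq (F : Finset (Finset (Tile v))) :
    ∃ F' : Finset (Finset (Tile v × Fin 1)), coloredTilingSpace F' = tilingSpace F := by
  classical
  refine ⟨F.image fun P => P.image fun τ => (τ, 0), ?_⟩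
  have key : ∀ (P : Finset (Tile v)) (T : Set (Tile v)) (c : T → Fin 1),
      ColoredOccurs (P.image fun τ => (τ, (0 : Fin 1))) T c ↔ Occurs P T := by
    intro P T c
    refine exists_congr fun u => ?_
    simp only [Finset.forall_mem_image]
    exact forall₂_congr fun τ _ => ⟨fun ⟨h, _⟩ => h, fun h => ⟨h, Subsingleton.elim _ _⟩⟩
  ext T
  simp only [coloredTilingSpace, tilingSpace, mem_ofPred_eq, Finset.forall_mem_image, key]
  exact and_congr_right fun _ => ⟨fun ⟨_, h⟩ => h, fun h => ⟨fun _ => 0, h⟩⟩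

theorem exists_enforces {ρ : RuleType} {𝓔 : Set (Plane d n)}
    (h : AdmitsLocalRules v ρ 𝓔 ∨ AdmitsColoredLocalRules v ρ 𝓔) :
    ∃ (k : ℕ) (F : Finset (Finset (Tile v × Fin k))) (t : ℕ),
      Enforces .weakened t (coloredTilingSpace F) 𝓔 := by
  rcases h with ⟨F, t, ht, h⟩ | ⟨k, F, t, ht, h⟩
  · obtain ⟨F', hF'⟩ := exists_coloredTilingSpace_eq F
    exact ⟨1, F', t, hF' ▸ h.weakened ht⟩
  · exact ⟨k, F, t, h.weakened ht⟩

end Reduction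

/-! ### Recursively open sets -/

section RecursivelyOpen

variable {n d : ℕ}

theorem planeDist_nonneg (E F : Plane d n) : 0 ≤ planeDist E F := by
  refine le_max_of_le_left (Real.sSup_nonneg ?_)
  rintro _ ⟨x, -, rfl⟩
  exact Metric.infDist_nonneg

theorem recursivelyOpen_ball {M : Fin d → Fin n → ℕ × ℕ × ℕ} {E : Plane d n} (hM : IsPlaneCode M E)
    (r : ℕ × ℕ × ℕ) : RecursivelyOpen {G | planeDist G E < ((ratOfCode r : ℚ) : ℝ)} :=
  ⟨fun _ => M, fun _ => r, fun _ => E, Computable.const _, Computable.const _, fun _ => hM,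
    (iUnion_const _).symm⟩

theorem recursivelyOpen_empty (hdn : d ≤ n) : RecursivelyOpen (∅ : Set (Plane d n)) := by
  have h := recursivelyOpen_ball
    (isPlaneCode_gridCode (Fin.castLE_injective hdn) 0 fun _ _ => 0) (0, 0, 0)
  convert h using 1
  refine (eq_empty_of_forall_notMem fun G hG => ?_).symm
  have := planeDist_nonneg G (isReduced_gridMatrix (Fin.castLE_injective hdn) 0 fun _ _ => 0).plane
  simp only [mem_ofPred_eq, ratOfCode] at hG
  norm_num at hG
  exact hG.not_ge this

theorem computable_interleave {α : Type*} [Primcodable α] {f g : ℕ → α} (hf : Computable f)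
    (hg : Computable g) : Computable fun k : ℕ => bif k.bodd then f k.div2 else g k.div2 :=
  Computable.cond Primrec.nat_bodd.to_comp (hf.comp Primrec.nat_div2.to_comp)
    (hg.comp Primrec.nat_div2.to_comp)

theorem RecursivelyOpen.union {A B : Set (Plane d n)} (hA : RecursivelyOpen A)
    (hB : RecursivelyOpen B) : RecursivelyOpen (A ∪ B) := by
  obtain ⟨q, r, P, hq, hr, hP, rfl⟩ := hA
  obtain ⟨q', r', P', hq', hr', hP', rfl⟩ := hB
  refine ⟨_, _, fun k => bif k.bodd then P k.div2 else P' k.div2, computable_interleave hq hq',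
    computable_interleave hr hr', fun k => ?_, ?_⟩
  · dsimp only
    cases k.bodd
    · exact hP' _
    · exact hP _
  · ext G
    simp only [mem_union, mem_iUnion, mem_ofPred_eq]
    constructor
    · rintro (⟨k, hk⟩ | ⟨k, hk⟩)
      · refine ⟨2 * k + 1, ?_⟩
        have h1 : (2 * k + 1).bodd = true := by simp
        have h2 : (2 * k + 1).div2 = k := by rw [Nat.div2_val]; omega
        rw [h1, h2]
        exact hk
      · refine ⟨2 * k, ?_⟩
        have h1 : (2 * k).bodd = false := by simp
        have h2 : (2 * k).div2 = k := by rw [Nat.div2_val]; omega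
        rw [h1, h2]
        exact hk
    · rintro ⟨k, hk⟩
      cases h : k.bodd
      · rw [h] at hk
        exact Or.inr ⟨_, hk⟩
      · rw [h] at hk
        exact Or.inl ⟨_, hk⟩

theorem recursivelyOpen_iUnion (hdn : d ≤ n) {κ : Type*} [Finite κ] {A : κ → Set (Plane d n)}
    (h : ∀ x, RecursivelyOpen (A x)) : RecursivelyOpen (⋃ x, A x) := by
  classical
  have := Fintype.ofFinite κ
  have key : ∀ s : Finset κ, RecursivelyOpen (⋃ x ∈ s, A x) := by
    intro s
    induction s using Finset.induction_on with
    | empty => simpa using recursivelyOpen_empty hdn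
    | insert x s _ ih =>
      rw [Finset.set_biUnion_insert]
      exact (h x).union ih
  simpa using key Finset.univ

end RecursivelyOpen

/-! ### Rational balls at a given scale -/

section Scales

variable {n d : ℕ}

/-- The rational plane coded by `a` at scale `R`. -/
def gridPlane {ι : Fin d → Fin n} (hι : Function.Injective ι) (R a : ℕ) : Plane d n :=
  (isReduced_gridMatrix hι (gridDen n R) (gridNum n d R a)).plane

/-- The radius of the balls used at scale `R`. -/
def gridRadius (n R : ℕ) : ℕ × ℕ × ℕ := (1, 0, n * R)

theorem ratOfCode_gridRadius (n R : ℕ) :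
    ((ratOfCode (gridRadius n R) : ℚ) : ℝ) = 1 / (n * R + 1) := by
  simp [ratOfCode, gridRadius]

variable {ι : Fin d → Fin n} {A : Fin d → Fin n → ℝ}

theorem abs_gridMat_le (hι : Function.Injective ι) (R a : ℕ) (i : Fin d) (j : Fin n) :
    |gridMat ι R a i j| ≤ 1 := abs_gridMatrix_le hι (gridNum_le n d R a) i j

/-- Every plane is in the ball, at each scale, of some rational plane. -/
theorem IsReduced.exists_gridPlane (h : IsReduced ι A) (hA : ∀ i j, |A i j| ≤ 1) (hdn : d ≤ n)
    (R : ℕ) : ∃ a < gridBase n R ^ (d * n),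
      (∀ i j, |A i j - gridMat ι R a i j| ≤ 1 / (gridDen n R + 1)) ∧
      planeDist h.plane (gridPlane h.injective R a) < 1 / (n * R + 1) := by
  obtain ⟨α, hα, hα'⟩ := h.exists_grid hA (gridDen n R)
  obtain ⟨a, ha, rfl⟩ := exists_gridNum_eq hα
  refine ⟨a, ha, hα', ?_⟩
  have h1 := h.planeDist_le (isReduced_gridMatrix h.injective (gridDen n R) (gridNum n d R a)) hα'
    (by positivity)
  refine h1.trans_lt ?_
  have hM : (gridDen n R : ℝ) = n * n * (n * R + 1) := by simp [gridDen]
  have hd : (d : ℝ) ≤ n := Nat.cast_le.2 hdn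
  have hpos : (0 : ℝ) < n * R + 1 := by positivity
  rw [hM, mul_one_div, mul_div_assoc', div_lt_div_iff₀ (by positivity) hpos]
  have : (n * d : ℝ) * (n * R + 1) ≤ n * n * (n * R + 1) := by gcongr
  linarith

theorem le_gridDen (hn : 0 < n) (R : ℕ) : R ≤ gridDen n R := by
  unfold gridDen
  nlinarith [Nat.mul_le_mul_right R hn, Nat.mul_le_mul hn hn, Nat.zero_le R,
    Nat.mul_le_mul (Nat.mul_le_mul hn hn) (Nat.mul_le_mul_right R hn)]

open Filter Topology in
theorem tendsto_gridMat (hn : 0 < n) {a : ℕ → ℕ}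
    (ha : ∀ R i j, |A i j - gridMat ι R (a R) i j| ≤ 1 / (gridDen n R + 1)) (i : Fin d)
    (j : Fin n) : Tendsto (fun R => gridMat ι R (a R) i j) atTop (𝓝 (A i j)) := by
  refine tendsto_iff_norm_sub_tendsto_zero.2 (squeeze_zero (fun _ => norm_nonneg _) (fun R => ?_)
    (tendsto_one_div_add_atTop_nhds_zero_nat (𝕜 := ℝ)))
  rw [Real.norm_eq_abs, abs_sub_comm]
  refine (ha R i j).trans ?_
  have : (R : ℝ) ≤ gridDen n R := Nat.cast_le.2 (le_gridDen hn R)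
  gcongr

/-- The transversality to the kernel of the projection passes to nearby planes. -/
theorem slope_bound_of_close {v : Fin n → Fin d → ℝ} {E G : Plane d n} {c ρ : ℝ} (hc : 0 ≤ c)
    (hE : ∀ y ∈ E.1, ‖y‖ ≤ c * ‖proj v y‖) (hEG : planeDist G E < ρ) (hρ : ρ ≤ 1 / 4)
    (hρ' : c * diamBound v * ρ ≤ 1 / 4) : ∀ y ∈ G.1, ‖y‖ ≤ 2 * c * ‖proj v y‖ := by
  intro y hy
  obtain ⟨y', hy', hyy'⟩ := exists_mem_of_planeDist_lt hEG hy
  have h1 : ‖y‖ ≤ ‖y - y'‖ + ‖y'‖ := by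
    calc ‖y‖ = ‖(y - y') + y'‖ := by congr 1; abel
      _ ≤ _ := norm_add_le _ _
  have h2 : ‖proj v y'‖ ≤ ‖proj v y‖ + diamBound v * (ρ * ‖y‖) := by
    calc ‖proj v y'‖ = ‖proj v y - proj v (y - y')‖ := by rw [map_sub]; congr 1; abel
      _ ≤ _ := norm_sub_le _ _
      _ ≤ _ := by
        have := (norm_proj_le (v := v) (y - y')).trans
          (mul_le_mul_of_nonneg_left hyy' (diamBound_nonneg v))
        linarith
  have h3 := (hE y' hy').trans (mul_le_mul_of_nonneg_left h2 hc)
  have h4 : ρ * ‖y‖ ≤ 1 / 4 * ‖y‖ := mul_le_mul_of_nonneg_right hρ (norm_nonneg y)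
  have h5 : c * diamBound v * ρ * ‖y‖ ≤ 1 / 4 * ‖y‖ :=
    mul_le_mul_of_nonneg_right hρ' (norm_nonneg y)
  nlinarith

theorem IsPlanar.slope_bound {v : Fin n → Fin d → ℝ} {c : ℝ}
    (hc : ∀ T : Set (Tile v), IsTiling v T → ∀ L, IsLift T L → ∀ (E : Plane d n) (D : ℝ),
      NearPlane T L E.1 D → ∀ y ∈ E.1, ‖y‖ ≤ c * ‖proj v y‖)
    {T : Set (Tile v)} (hT : IsTiling v T) {E : Plane d n} {t : ℕ} (h : IsPlanar T E t) :
    ∀ y ∈ E.1, ‖y‖ ≤ c * ‖proj v y‖ := by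
  obtain ⟨L, hL, hnear⟩ := h.exists_nearPlane
  exact hc T hT L hL E _ hnear

end Scales

/-! ### Sets of planes with local rules are recursively closed -/

section Closed

variable {n d k : ℕ} {v : Fin n → Fin d → ℝ} {F : Finset (Finset (Tile v × Fin k))}

/-- The balls which are certified to avoid the slopes, at all scales, by the absence of
configurations. -/
def certified (F : Finset (Finset (Tile v × Fin k))) (C D : ℕ) {ι : Fin d → Fin n}
    (hι : Function.Injective ι) : Set (Plane d n) :=
  {G | ∃ R a, ¬ HasConfig F C D ι (R, a) ∧ planeDist G (gridPlane hι R a) < 1 / (n * R + 1)}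

theorem recursivelyOpen_certified (C D : ℕ) {ι : Fin d → Fin n} (hι : Function.Injective ι) :
    RecursivelyOpen (certified F C D hι) := by
  classical
  have hR : Primrec fun s : ℕ => s.unpair.1 := Primrec.fst.comp Primrec.unpair
  have ha : Primrec fun s : ℕ => s.unpair.2 := Primrec.snd.comp Primrec.unpair
  refine ⟨fun s => gridCode ι (gridDen n s.unpair.1) (gridNum n d s.unpair.1 s.unpair.2),
    fun s => if HasConfig F C D ι s.unpair then (0, 0, 0) else gridRadius n s.unpair.1,
    fun s => gridPlane hι s.unpair.1 s.unpair.2, (primrec_gridCode hR ha ι).to_comp,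
    (Primrec.ite ((primrecPred_hasConfig hι).comp Primrec.unpair) (Primrec.const _)
      ((Primrec.const _).pair ((Primrec.const _).pair (primrec_mul (Primrec.const n) hR)))).to_comp,
    fun s => isPlaneCode_gridCode hι _ _, ?_⟩
  ext G
  simp only [certified, mem_ofPred_eq, mem_iUnion]
  constructor
  · rintro ⟨R, a, hno, hG⟩
    refine ⟨Nat.pair R a, ?_⟩
    rw [Nat.unpair_pair, if_neg hno, ratOfCode_gridRadius]
    exact hG
  · rintro ⟨s, hs⟩
    by_cases h : HasConfig F C D ι s.unpair
    · rw [if_pos h] at hs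
      have := planeDist_nonneg G (gridPlane hι s.unpair.1 s.unpair.2)
      simp only [ratOfCode] at hs
      norm_num at hs
      exact absurd this hs.not_ge
    · rw [if_neg h, ratOfCode_gridRadius] at hs
      exact ⟨_, _, h, hs⟩

/-- A bound for the error with which the lifts of tilings of thickness `t` satisfy the equations of
a rational plane close to their slope. -/
def nearBound (n d t : ℕ) : ℕ := (d + 1) * (2 * (n * t) + 1)

/-- Soundness of the test: the rational planes that are close enough to a slope pass it. -/
theorem Enforces.hasConfig {𝓔 : Set (Plane d n)} {t : ℕ}
    (h : Enforces .weakened t (coloredTilingSpace F) 𝓔) {E : Plane d n} (hE : E ∈ 𝓔) (C : ℕ)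
    {ι : Fin d → Fin n} (hι : Function.Injective ι) {R a : ℕ}
    (hR : planeDist E (gridPlane hι R a) < 1 / (n * R + 1)) :
    HasConfig F C (nearBound n d t) ι (R, a) := by
  obtain ⟨T, hT, hTE⟩ := h.1 E hE
  replace hTE : IsPlanar T E t := hTE
  have := exists_boxConfig hT hTE C
    (isReduced_gridMatrix hι (gridDen n R) (gridNum n d R a)) (abs_gridMat_le hι R a) hR
  simpa [HasConfig, nearBound, gridMat] using this

theorem exists_small_scale (hn : 0 < n) {c : ℝ} (hc : 0 ≤ c) (v : Fin n → Fin d → ℝ) :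
    ∃ R : ℕ, 1 / ((n : ℝ) * R + 1) ≤ 1 / 4 ∧ c * diamBound v * (1 / (n * R + 1)) ≤ 1 / 4 := by
  obtain ⟨R, hR⟩ := exists_nat_ge (4 + 4 * (c * diamBound v))
  have h0 : 0 ≤ c * diamBound v := mul_nonneg hc (diamBound_nonneg v)
  have h1 : (R : ℝ) ≤ n * R := by
    exact_mod_cast Nat.le_mul_of_pos_left R hn
  have hpos : (0 : ℝ) < n * R + 1 := by positivity
  refine ⟨R, ?_, ?_⟩
  · exact one_div_le_one_div_of_le (by norm_num) (by linarith)
  · rw [mul_one_div, div_le_iff₀ hpos]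
    linarith

open Filter Topology in
theorem Enforces.recursivelyClosed (hdn : d < n) {𝓔 : Set (Plane d n)} {t : ℕ}
    (h : Enforces .weakened t (coloredTilingSpace F) 𝓔) : RecursivelyClosed 𝓔 := by
  classical
  have hn : 0 < n := by omega
  obtain ⟨c, hc, hslope⟩ := exists_slope_bound v
  have h𝓔 : ∀ E ∈ 𝓔, ∀ y ∈ E.1, ‖y‖ ≤ c * ‖proj v y‖ := by
    intro E hE
    obtain ⟨T, hT, hTE⟩ := h.1 E hE
    exact hTE.slope_bound hslope hT.1
  obtain ⟨C, hC⟩ := exists_window h.2 (c := 2 * (2 * c)) (by positivity)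
    (D := (nearBound n d t : ℕ)) (Nat.cast_nonneg _)
  obtain ⟨R₀, hR₀, hR₀'⟩ := exists_small_scale hn (c := 2 * c) (by positivity) v
  have hR₀'' : c * diamBound v * (1 / (n * R₀ + 1)) ≤ 1 / 4 := by
    refine le_trans ?_ hR₀'
    have h0 : 0 ≤ c * diamBound v := mul_nonneg hc.le (diamBound_nonneg v)
    have : (0 : ℝ) ≤ 1 / (n * R₀ + 1) := by positivity
    exact mul_le_mul_of_nonneg_right (by linarith) this
  -- finitely many balls deal with the planes that are too close to the kernel of the projection
  have hopen : RecursivelyOpen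
      ((⋃ ι : {ι : Fin d → Fin n // Function.Injective ι},
        certified F C (nearBound n d t) ι.2) ∪
      ⋃ x : {x : {ι : Fin d → Fin n // Function.Injective ι} × Fin (gridBase n R₀ ^ (d * n)) //
        ∀ E ∈ 𝓔, ¬ planeDist E (gridPlane x.1.2 R₀ x.2) < 1 / (n * R₀ + 1)},
        {G | planeDist G (gridPlane x.1.1.2 R₀ x.1.2) <
          ((ratOfCode (gridRadius n R₀) : ℚ) : ℝ)}) :=
    (recursivelyOpen_iUnion hdn.le fun ι => recursivelyOpen_certified _ _ ι.2).union
      (recursivelyOpen_iUnion hdn.le fun x => recursivelyOpen_ball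
        (isPlaneCode_gridCode x.1.1.2 _ _) _)
  change RecursivelyOpen 𝓔ᶜ
  convert hopen using 1
  ext G
  simp only [mem_compl_iff, mem_union, mem_iUnion, mem_ofPred_eq, ratOfCode_gridRadius]
  constructor
  · intro hG
    obtain ⟨ι, A, hA, hA1, rfl⟩ := exists_isReduced hn G
    by_cases hb : ∀ y ∈ hA.plane.1, ‖y‖ ≤ 2 * (2 * c) * ‖proj v y‖
    · left
      choose a ha ha' using fun R => hA.exists_gridPlane hA1 hdn.le R
      refine ⟨⟨ι, hA.injective⟩, ?_⟩
      by_contra hno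
      have hall : ∀ R, HasConfig F C (nearBound n d t) ι (R, a R) := by
        intro R
        by_contra hR
        exact hno ⟨R, a R, hR, (ha' R).2⟩
      refine hG (hC ι (fun R => gridMat ι R (a R)) A hA id (hyperfilter ℕ) ?_
        (Eventually.of_forall hall) ?_ hb)
      · exact Nat.hyperfilter_le_atTop
      · intro i j
        exact (tendsto_gridMat hn (fun R => (ha' R).1) i j).mono_left Nat.hyperfilter_le_atTop
    · right
      obtain ⟨a, ha, -, hG'⟩ := hA.exists_gridPlane hA1 hdn.le R₀
      refine ⟨⟨(⟨ι, hA.injective⟩, ⟨a, ha⟩), fun E hE hEQ => hb ?_⟩, hG'⟩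
      refine slope_bound_of_close (by positivity) ?_ hG' hR₀ hR₀'
      exact slope_bound_of_close hc.le (h𝓔 E hE) (by rw [planeDist_comm]; exact hEQ) hR₀ hR₀''
  · rintro (⟨ι, R, a, hno, hG⟩ | ⟨x, hx⟩) hG𝓔
    · exact hno (h.hasConfig hG𝓔 C ι.2 hG)
    · exact x.2 G hG𝓔 hx

end Closed

/-! ### Computability of a single slope -/

section Computable

variable {n d k : ℕ} {v : Fin n → Fin d → ℝ} {F : Finset (Finset (Tile v × Fin k))}

/-- The entries of two rational matrices, with denominators `m + 1` and `m' + 1`, differ by at most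
`e / f`, as inequalities between natural numbers. -/
def GridClose (ι : Fin d → Fin n) (m : ℕ) (α : Fin d → Fin n → ℕ) (m' : ℕ)
    (α' : Fin d → Fin n → ℕ) (e f : ℕ) : Prop :=
  ∀ (i : Fin d) (j : {j // j ∉ range ι}),
    α i j * (m' + 1) * f ≤ α' i j * (m + 1) * f + e * (m + 1) * (m' + 1) ∧
    α' i j * (m + 1) * f ≤ α i j * (m' + 1) * f + e * (m + 1) * (m' + 1)

theorem gridClose_iff {ι : Fin d → Fin n} (hι : Function.Injective ι) {m m' e f : ℕ} (hf : 0 < f)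
    (α α' : Fin d → Fin n → ℕ) :
    GridClose ι m α m' α' e f ↔
      ∀ i j, |gridMatrix ι m α i j - gridMatrix ι m' α' i j| ≤ (e : ℝ) / f := by
  have key : ∀ (i : Fin d) (j : {j // j ∉ range ι}),
      |gridMatrix ι m α i j - gridMatrix ι m' α' i j| ≤ (e : ℝ) / f ↔
      α i j * (m' + 1) * f ≤ α' i j * (m + 1) * f + e * (m + 1) * (m' + 1) ∧
      α' i j * (m + 1) * f ≤ α i j * (m' + 1) * f + e * (m + 1) * (m' + 1) := by
    intro i j
    rw [gridMatrix_of_notMem j.2, gridMatrix_of_notMem j.2]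
    have hm : (0 : ℝ) < m + 1 := by positivity
    have hm' : (0 : ℝ) < m' + 1 := by positivity
    have hf' : (0 : ℝ) < f := Nat.cast_pos.2 hf
    have h1 : (α i j / (m + 1) - 1 - (α' i j / (m' + 1) - 1) : ℝ) =
        (α i j * (m' + 1) * f - α' i j * (m + 1) * f) / ((m + 1) * (m' + 1) * f) := by
      field_simp
      ring
    have h2 : (e : ℝ) / f = e * (m + 1) * (m' + 1) / ((m + 1) * (m' + 1) * f) := by
      field_simp
    have hpos : (0 : ℝ) < (m + 1) * (m' + 1) * f := by positivity
    rw [h1, h2, abs_div, abs_of_pos hpos, div_le_div_iff_of_pos_right hpos, abs_sub_le_iff,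
      sub_le_iff_le_add', sub_le_iff_le_add']
    norm_cast
  constructor
  · intro h i j
    by_cases hj : j ∈ range ι
    · obtain ⟨i', rfl⟩ := hj
      rw [isReduced_gridMatrix hι, isReduced_gridMatrix hι, sub_self, abs_zero]
      positivity
    · exact (key i ⟨j, hj⟩).2 (h i ⟨j, hj⟩)
  · exact fun h i j => (key i j).1 (h i j)

theorem primrecPred_gridClose {α : Type*} [Primcodable α] {ι : Fin d → Fin n} {m m' e f : α → ℕ}
    {A A' : α → Fin d → Fin n → ℕ} (hm : Primrec m) (hA : ∀ i j, Primrec fun x => A x i j)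
    (hm' : Primrec m') (hA' : ∀ i j, Primrec fun x => A' x i j) (he : Primrec e)
    (hf : Primrec f) :
    PrimrecPred fun x => GridClose ι (m x) (A x) (m' x) (A' x) (e x) (f x) := by
  have h1 := primrec_add hm (Primrec.const 1)
  have h1' := primrec_add hm' (Primrec.const 1)
  refine primrecPred_forall_finite fun i => primrecPred_forall_finite fun j => ?_
  have hX := primrec_mul (primrec_mul (hA i j) h1') hf
  have hX' := primrec_mul (primrec_mul (hA' i j) h1) hf
  have hY := primrec_mul (primrec_mul he h1) h1'
  exact (primrecPred_le hX (primrec_add hX' hY)).and (primrecPred_le hX' (primrec_add hX hY))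

/-- At scale `R`, the matrix coded by `a` is close to the fixed rational matrix of numerators `γ`,
and there are configurations near its plane. -/
def Candidate (F : Finset (Finset (Tile v × Fin k))) (C D : ℕ) (ι : Fin d → Fin n) (g : ℕ)
    (γ : Fin d → Fin n → ℕ) (R a : ℕ) : Prop :=
  a < gridBase n R ^ (d * n) ∧
  GridClose ι (gridDen n R) (gridNum n d R a) g γ 2 (g + 1) ∧ HasConfig F C D ι (R, a)

/-- The scale and the candidate coded by `s` determine the slope with precision `1 / (m + 1)`: all
other candidates at this scale are close. -/
def Determines (F : Finset (Finset (Tile v × Fin k))) (C D : ℕ) (ι : Fin d → Fin n) (g : ℕ)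
    (γ : Fin d → Fin n → ℕ) (m s : ℕ) : Prop :=
  2 * n * n * (m + 1) ≤ s.unpair.1 ∧ g ≤ s.unpair.1 ∧
  Candidate F C D ι g γ s.unpair.1 s.unpair.2 ∧
  ∀ a < gridBase n s.unpair.1 ^ (d * n), Candidate F C D ι g γ s.unpair.1 a →
    GridClose ι (gridDen n s.unpair.1) (gridNum n d s.unpair.1 s.unpair.2)
      (gridDen n s.unpair.1) (gridNum n d s.unpair.1 a) 1 (2 * n * n * (m + 1))

theorem primrecPred_candidate {α : Type*} [Primcodable α] {C D : ℕ} {ι : Fin d → Fin n}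
    (hι : Function.Injective ι) {g : ℕ} {γ : Fin d → Fin n → ℕ} {f h : α → ℕ} (hf : Primrec f)
    (hh : Primrec h) : PrimrecPred fun x => Candidate F C D ι g γ (f x) (h x) :=
  (primrecPred_lt hh (primrec_pow (primrec_gridBase hf) (Primrec.const _))).and
    ((primrecPred_gridClose (m' := fun _ => g) (A' := fun _ => γ) (primrec_gridDen hf)
      (fun i j => primrec_gridNum hf hh i j) (Primrec.const g) (fun i j => Primrec.const (γ i j))
      (Primrec.const 2) (Primrec.const (g + 1))).and
      ((primrecPred_hasConfig hι).comp (hf.pair hh)))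

theorem primrecPred_determines {C D : ℕ} {ι : Fin d → Fin n}
    (hι : Function.Injective ι) {g : ℕ} {γ : Fin d → Fin n → ℕ} :
    PrimrecPred fun x : ℕ × ℕ => Determines F C D ι g γ x.1 x.2 := by
  have hu : Primrec fun x : ℕ × ℕ => x.2.unpair := Primrec.unpair.comp Primrec.snd
  have hR : Primrec fun x : ℕ × ℕ => x.2.unpair.1 := Primrec.fst.comp hu
  have ha : Primrec fun x : ℕ × ℕ => x.2.unpair.2 := Primrec.snd.comp hu
  have hK : Primrec fun x : ℕ × ℕ => 2 * n * n * (x.1 + 1) :=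
    primrec_mul (Primrec.const _) (primrec_add Primrec.fst (Primrec.const _))
  refine (primrecPred_le hK hR).and ((primrecPred_le (Primrec.const _) hR).and
    ((primrecPred_candidate hι hR ha).and (primrecPred_forall_lt
      (primrec_pow (primrec_gridBase hR) (Primrec.const _)) (primrecPred_imp
        (primrecPred_candidate hι (hR.comp Primrec.fst) Primrec.snd) ?_))))
  exact primrecPred_gridClose (primrec_gridDen (hR.comp Primrec.fst))
    (fun i j => primrec_gridNum (hR.comp Primrec.fst) (ha.comp Primrec.fst) i j)
    (primrec_gridDen (hR.comp Primrec.fst))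
    (fun i j => primrec_gridNum (hR.comp Primrec.fst) Primrec.snd i j)
    (Primrec.const _) (hK.comp Primrec.fst)

open Filter Topology in
theorem Enforces.computablePlane (hdn : d < n) {E : Plane d n} {t : ℕ}
    (h : Enforces .weakened t (coloredTilingSpace F) {E}) : ComputablePlane E := by
  classical
  have hn : 0 < n := by omega
  have hd : (d : ℝ) ≤ n := Nat.cast_le.2 hdn.le
  obtain ⟨c, hc, hslope⟩ := exists_slope_bound v
  have hE : ∀ y ∈ E.1, ‖y‖ ≤ c * ‖proj v y‖ := by
    obtain ⟨T, hT, hTE⟩ := h.1 E rfl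
    exact hTE.slope_bound hslope hT.1
  obtain ⟨C, hC⟩ := exists_window h.2 (c := 2 * c) (by positivity)
    (D := (nearBound n d t : ℕ)) (Nat.cast_nonneg _)
  obtain ⟨R₀, hR₀, hR₀'⟩ := exists_small_scale hn hc.le v
  obtain ⟨ι, A, hA, hA1, rfl⟩ := exists_isReduced hn E
  have hι := hA.injective
  -- a rational approximation of `A`, so fine that the nearby planes are transverse to the kernel
  -- of the projection
  set g : ℕ := 3 * (n * n * (n * R₀ + 1)) with hg
  obtain ⟨γ, -, hγ⟩ := hA.exists_grid hA1 g
  have hnear : ∀ (A' : Fin d → Fin n → ℝ) (hA' : IsReduced ι A'),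
      (∀ i j, |A' i j - gridMatrix ι g γ i j| ≤ 2 / (g + 1)) →
      ∀ y ∈ hA'.plane.1, ‖y‖ ≤ 2 * c * ‖proj v y‖ := by
    intro A' hA' hclose
    have h1 : ∀ i j, |A' i j - A i j| ≤ 3 / (g + 1) := fun i j => by
      have h2 := hclose i j
      have h3 := hγ i j
      rw [abs_sub_comm] at h3
      calc |A' i j - A i j| ≤ |A' i j - gridMatrix ι g γ i j| + |gridMatrix ι g γ i j - A i j| :=
            abs_sub_le _ _ _
        _ ≤ 2 / (g + 1) + 1 / (g + 1) := add_le_add h2 h3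
        _ = 3 / (g + 1) := by ring
    refine slope_bound_of_close hc.le hE ((hA'.planeDist_le hA h1 (by positivity)).trans_lt ?_)
      hR₀ hR₀'
    have hpos : (0 : ℝ) < n * R₀ + 1 := by positivity
    have hgr : (g : ℝ) = 3 * (n * n * (n * R₀ + 1)) := by rw [hg]; push_cast; ring
    rw [mul_div_assoc', mul_div_assoc', div_lt_div_iff₀ (by positivity) hpos, hgr]
    have : (n * d : ℝ) * (n * R₀ + 1) ≤ n * n * (n * R₀ + 1) := by gcongr
    linarith
  -- the grid point next to `A` is a candidate at all large scales
  have hcand : ∀ R, g ≤ R → ∃ a, Candidate F C (nearBound n d t) ι g γ R a ∧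
      ∀ i j, |A i j - gridMat ι R a i j| ≤ 1 / (gridDen n R + 1) := by
    intro R hgR
    obtain ⟨a, ha, haA, hdist⟩ := hA.exists_gridPlane hA1 hdn.le R
    refine ⟨a, ⟨ha, (gridClose_iff hι (Nat.succ_pos g) _ _).2 fun i j => ?_,
      h.hasConfig rfl C hι hdist⟩, haA⟩
    have h2 := haA i j
    have h3 := hγ i j
    rw [abs_sub_comm] at h2
    have h4 : (g : ℝ) ≤ gridDen n R := Nat.cast_le.2 (hgR.trans (le_gridDen hn R))
    have h5 : 1 / ((gridDen n R : ℝ) + 1) ≤ 1 / (g + 1) := by gcongr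
    push_cast
    calc _ ≤ |gridMat ι R a i j - A i j| + |A i j - gridMatrix ι g γ i j| := abs_sub_le _ _ _
      _ ≤ 1 / (g + 1) + 1 / (g + 1) := by linarith
      _ = 2 / (g + 1) := by ring
  -- otherwise candidates that stay far from `A` would accumulate at another slope
  have hexists : ∀ m, ∃ s, Determines F C (nearBound n d t) ι g γ m s := by
    intro m
    by_contra! hno
    set K := 2 * n * n * (m + 1) with hK
    have hKpos : 0 < K := by positivity
    have hbad : ∀ R, max K g ≤ R → ∃ a b, Candidate F C (nearBound n d t) ι g γ R b ∧
        (∀ i j, |A i j - gridMat ι R a i j| ≤ 1 / (gridDen n R + 1)) ∧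
        ¬ GridClose ι (gridDen n R) (gridNum n d R a) (gridDen n R) (gridNum n d R b) 1 K := by
      intro R hR
      obtain ⟨a, ha, haA⟩ := hcand R ((le_max_right _ _).trans hR)
      by_contra! hall
      refine hno (Nat.pair R a) ?_
      simp only [Determines, Nat.unpair_pair]
      exact ⟨(le_max_left _ _).trans hR, (le_max_right _ _).trans hR, ha,
        fun b _ hb => hall a b hb haA⟩
    choose! a b hb haA hab using hbad
    set l := hyperfilter ℕ
    have hl : (l : Filter ℕ) ≤ atTop := Nat.hyperfilter_le_atTop
    have hev : ∀ᶠ R in (l : Filter ℕ), max K g ≤ R := hl (eventually_ge_atTop _)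
    have hlim : ∀ i j, ∃ x, Tendsto (fun R => gridMat ι R (b R) i j) l (𝓝 x) := by
      intro i j
      obtain ⟨x, -, hx⟩ := (isCompact_Icc (a := (-1 : ℝ)) (b := 1)).ultrafilter_le_nhds
        (l.map fun R => gridMat ι R (b R) i j) (by
          rw [le_principal_iff]
          exact Filter.mem_map.2 (Eventually.of_forall fun R : ℕ =>
            abs_le.1 (abs_gridMat_le hι R (b R) i j)))
      exact ⟨x, hx⟩
    choose A' hA'lim using hlim
    have hA' : IsReduced ι A' := fun i i' =>
      tendsto_nhds_unique (hA'lim i (ι i')) (tendsto_const_nhds.congr fun R =>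
        (isReduced_gridMatrix hι (gridDen n R) (gridNum n d R (b R)) i i').symm)
    have hA'γ : ∀ i j, |A' i j - gridMatrix ι g γ i j| ≤ 2 / (g + 1) := by
      intro i j
      refine le_of_tendsto ((hA'lim i j).sub_const _).abs ?_
      filter_upwards [hev] with R hR
      have := (gridClose_iff hι (Nat.succ_pos g) _ _).1 (hb R hR).2.1 i j
      push_cast at this
      exact this
    have hmem : hA'.plane = hA.plane := hC ι (fun R => gridMat ι R (b R)) A' hA' id l hl
      (hev.mono fun R hR => (hb R hR).2.2) hA'lim (hnear A' hA' hA'γ)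
    have hAA' : A' = A := hA'.plane_injective hA hmem
    subst hAA'
    have hKr : (0 : ℝ) < 1 / (2 * K) := by positivity
    have hev1 : ∀ᶠ R in (l : Filter ℕ), ∀ i j, |gridMat ι R (b R) i j - A' i j| < 1 / (2 * K) :=
      eventually_all.2 fun i => eventually_all.2 fun j =>
        Metric.tendsto_nhds.1 (hA'lim i j) _ hKr
    have hev2 : ∀ᶠ R : ℕ in (l : Filter ℕ), 1 / ((R : ℝ) + 1) < 1 / (2 * K) :=
      hl ((tendsto_one_div_add_atTop_nhds_zero_nat (𝕜 := ℝ)).eventually_lt_const hKr)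
    obtain ⟨R, hR, h1, h2⟩ := (hev.and (hev1.and hev2)).exists
    refine hab R hR ((gridClose_iff hι hKpos _ _).2 fun i j => ?_)
    have h3 := haA R hR i j
    rw [abs_sub_comm] at h3
    have h4 : (R : ℝ) ≤ gridDen n R := Nat.cast_le.2 (le_gridDen hn R)
    have h5 : 1 / ((gridDen n R : ℝ) + 1) ≤ 1 / (R + 1) := by gcongr
    have h6 := h1 i j
    rw [abs_sub_comm] at h6
    calc _ ≤ |gridMat ι R (a R) i j - A' i j| + |A' i j - gridMat ι R (b R) i j| :=
          abs_sub_le _ _ _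
      _ ≤ 1 / (2 * K) + 1 / (2 * K) := by linarith
      _ = ((1 : ℕ) : ℝ) / K := by push_cast; field_simp; norm_num
  have hfind := computable_nat_find (p := fun m s => Determines F C (nearBound n d t) ι g γ m s)
    (primrecPred_determines hι) hexists
  set s : ℕ → ℕ := fun m => Nat.find (hexists m) with hs
  refine ⟨fun m => gridCode ι (gridDen n (s m).unpair.1) (gridNum n d (s m).unpair.1
    (s m).unpair.2), fun m => gridPlane hι (s m).unpair.1 (s m).unpair.2,
    (primrec_gridCode (Primrec.fst.comp Primrec.unpair) (Primrec.snd.comp Primrec.unpair)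
      ι).to_comp.comp hfind, fun m => isPlaneCode_gridCode hι _ _, fun m => ?_⟩
  obtain ⟨hK, hgR, -, hall⟩ := Nat.find_spec (hexists m)
  change 2 * n * n * (m + 1) ≤ (s m).unpair.1 at hK
  change g ≤ (s m).unpair.1 at hgR
  obtain ⟨a, ha, haA⟩ := hcand _ hgR
  have hclose := (gridClose_iff hι (by positivity) _ _).1 (hall a ha.1 ha)
  have hKr : ((2 * n * n * (m + 1) : ℕ) : ℝ) ≤ gridDen n (s m).unpair.1 :=
    Nat.cast_le.2 (hK.trans (le_gridDen hn _))
  have hKpos : (0 : ℝ) < (2 * n * n * (m + 1) : ℕ) := Nat.cast_pos.2 (by positivity)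
  have hdist := (isReduced_gridMatrix hι (gridDen n (s m).unpair.1) (gridNum n d (s m).unpair.1
    (s m).unpair.2)).planeDist_le hA (η := 2 / (2 * n * n * (m + 1) : ℕ)) (fun i j => by
      have h2 := hclose i j
      have h3 := haA i j
      rw [abs_sub_comm] at h3
      have h5 : 1 / ((gridDen n (s m).unpair.1 : ℝ) + 1) ≤ 1 / (2 * n * n * (m + 1) : ℕ) :=
        one_div_le_one_div_of_le hKpos (by linarith)
      calc _ ≤ _ := abs_sub_le _ (gridMat ι (s m).unpair.1 a i j) _
        _ ≤ ((1 : ℕ) : ℝ) / (2 * n * n * (m + 1) : ℕ) +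
            1 / (2 * n * n * (m + 1) : ℕ) := add_le_add h2 (h3.trans h5)
        _ = _ := by push_cast; ring) (by positivity)
  refine hdist.trans ?_
  have hn' : (0 : ℝ) < n := Nat.cast_pos.2 hn
  push_cast
  rw [mul_div_assoc', mul_div_assoc', div_le_div_iff₀ (by positivity) (by positivity)]
  have : (n * d : ℝ) * (m + 1) ≤ n * n * (m + 1) := by gcongr
  linarith

end Computable

end PlanarTilings

end

theorem mainTheorem6 (n d : ℕ) (hd : 0 < d) (hdn : d < n) (v : Fin n → Fin d → ℝ)
    (hv : PlanarTilings.PairwiseNonColinear v) (ρ : PlanarTilings.RuleType) :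
    (∀ 𝓔 : Set (PlanarTilings.Plane d n),
      PlanarTilings.AdmitsLocalRules v ρ 𝓔 ∨ PlanarTilings.AdmitsColoredLocalRules v ρ 𝓔 →
        PlanarTilings.RecursivelyClosed 𝓔) ∧
    (∀ E : PlanarTilings.Plane d n,
      PlanarTilings.AdmitsLocalRules v ρ {E} ∨ PlanarTilings.AdmitsColoredLocalRules v ρ {E} →
        PlanarTilings.ComputablePlane E) := by
  refine ⟨fun 𝓔 h => ?_, fun E h => ?_⟩
  · obtain ⟨k, F, t, h⟩ := PlanarTilings.exists_enforces h
    exact h.recursivelyClosed hdn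
  · obtain ⟨k, F, t, h⟩ := PlanarTilings.exists_enforces h
    exact h.computablePlane hdn
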